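/- **Notation.** A partition is identified with its diagram; $\lambda_i$ is its $i$-th part, $l(\lambda)$ its number of positive parts, $\lambda_i=0$ for $i>l(\lambda)$, and $[\nu]$ is the irreducible character of the symmetric group labelled by the partition $\nu$. The Littlewood–Richardson coefficient $c(\lambda;\mu,\nu)$ is the number of semistandard tableaux of shape $\lambda/\mu$ and content $\nu$ whose reverse row word is a lattice word (it is $0$ if $\mu\not\subseteq\lambda$). Put $$[\lambda/\mu]=\sum_\nu c(\lambda;\mu,\nu)\,[\nu],\qquad [\alpha]\otimes[\beta]=\sum_\nu c(\nu;\alpha,\beta)\,[\nu],$$ and write $[\nu]\in\chi$ if $[\nu]$ has nonzero multiplicity in the character $\chi$. The Durfee size $d(\nu)$ is the largest $d$ such that the square $(d^d)$ is contained in $\nu$, and $d(\chi)=\max\{d(\nu) : [\nu]\in\chi\}$, with $d(\lambda/\mu)=d([\lambda/\mu])$. The principal hook length partition $hl(\nu)$ has as its $i$-th part the hook length of the box $(i,i)$ of $\nu$ (and $0$ if $(i,i)\notin\nu$); $hl(\chi)$ is the lexicographically largest $hl(\nu)$ with $[\nu]\in\chi$. For $\nu\subseteq(l^l)$ let $\nu^{-1}=(l^l)/\nu$,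 rotated by $180^\circ$, i.e. the partition with parts $\nu^{-1}_i=l-\nu_{l+1-i}$, $1\le i\le l$. **Proposition 5.4.** Let $\lambda=(\lambda_1^k,\lambda_{k+1},\dots,\lambda_l)$ and $\mu$ be partitions with $\lambda_1=l$, $k\ge l(\mu)$ and $\mu_1\le\lambda_l$, where $\lambda$ has at most $l$ positive parts. Then: 1. $d(\lambda/\mu)=l-\max\bigl(d(\mu),d(\lambda^{-1})\bigr)$. 2. There are at least $2^{\min(d(\mu),d(\lambda^{-1}))}$ different characters $[\nu]\in[\lambda/\mu]$ of maximal Durfee size $d(\nu)=d(\lambda/\mu)$, and at least $2^{\min(d(\mu),d(\lambda^{-1}))}$ of them appear with multiplicity $1$. 3. If $[\alpha]\in[\mu]\otimes[\lambda^{-1}]$ satisfies $hl(\alpha)=hl([\mu]\otimes[\lambda^{-1}])$, then $\alpha\subseteq(l^l)$, and $[\alpha^{-1}]=[(l^l)/\alpha]$ appears in $[\lambda/\mu]$, has maximal Durfee size $d(\alpha^{-1})=d(\lambda/\mu)$, and has multiplicity $1$. At least $2^{\min(d(\mu),d(\lambda^{-1}))}$ different characters of $[\lambda/\mu]$ are obtained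 in this way. -/

import Mathlib

/-! Partitions are Mathlib's Young diagrams, in matrix coordinates starting at `0`: for a partition
`lam`, the `i`-th part (counted from `0`) is `lam.rowLen i`, its length (number of positive parts)
is `lam.colLen 0`, and containment of diagrams is `≤`.

The irreducible character `[ν]` of a symmetric group is referred to by its partition `ν`, and a
character `χ = ∑ χ(ν) [ν]` by its multiplicity function `χ : YoungDiagram → ℕ`. -/

namespace SkewDurfee

/-- The function `T` is a Littlewood–Richardson tableau of shape `lam / mu` and
content `nu`. Entries are positive on the boxes of `lam / mu`; off these boxes `T` is `0`, so that
different functions are different tableaux. -/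
structure IsLRTableau (lam mu nu : YoungDiagram) (T : ℕ × ℕ → ℕ) : Prop where
  /-- the skew shape `lam / mu` is defined -/
  subset : mu ≤ lam
  pos : ∀ c ∈ lam.cells \ mu.cells, 0 < T c
  zero : ∀ c ∉ lam.cells \ mu.cells, T c = 0
  row_weak : ∀ i j₁ j₂, j₁ < j₂ → (i, j₁) ∈ lam.cells \ mu.cells →
    (i, j₂) ∈ lam.cells \ mu.cells → T (i, j₁) ≤ T (i, j₂)
  col_strict : ∀ i₁ i₂ j, i₁ < i₂ → (i₁, j) ∈ lam.cells \ mu.cells →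
    (i₂, j) ∈ lam.cells \ mu.cells → T (i₁, j) < T (i₂, j)
  /-- the entry `n + 1` occurs as often as the `n`-th part (from `0`) of `nu` says -/
  content : ∀ n, ((lam.cells \ mu.cells).filter fun c => T c = n + 1).card = nu.rowLen n
  /-- The reverse row word is a lattice word. The word reads the rows from top to bottom, each of
  them from right to left, so its nonempty initial segments are the entries of the boxes `c` that
  are read no later than some box `b`. -/
  lattice : ∀ b ∈ lam.cells \ mu.cells, ∀ n, 1 ≤ n →
    ((lam.cells \ mu.cells).filter fun c =>
      (c.1 < b.1 ∨ (c.1 = b.1 ∧ b.2 ≤ c.2)) ∧ T c = n + 1).card ≤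
    ((lam.cells \ mu.cells).filter fun c =>
      (c.1 < b.1 ∨ (c.1 = b.1 ∧ b.2 ≤ c.2)) ∧ T c = n).card

/-- The Littlewood–Richardson coefficient `c(lam; mu, nu)`: the number of LR tableaux of shape
`lam / mu` and content `nu`. -/
noncomputable def lrCoeff (lam mu nu : YoungDiagram) : ℕ :=
  {T : ℕ × ℕ → ℕ | IsLRTableau lam mu nu T}.ncard

/-- The skew character `[lam / mu] = ∑ c(lam; mu, ν) [ν]`. -/
noncomputable def skewChar (lam mu : YoungDiagram) : YoungDiagram → ℕ :=
  fun nu => lrCoeff lam mu nu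

/-- The product (induced from the Young subgroup) `[a] ⊗ [b] = ∑ c(ν; a, b) [ν]`. -/
noncomputable def prodChar (a b : YoungDiagram) : YoungDiagram → ℕ :=
  fun nu => lrCoeff nu a b

/-- The set of `ν` with `[ν] ∈ χ`, i.e. such that `[ν]` has nonzero multiplicity in `χ`. -/
def constituents (χ : YoungDiagram → ℕ) : Set YoungDiagram := {nu | χ nu ≠ 0}

/-- The square partition `(d^d)`. -/
def square (d : ℕ) : YoungDiagram where
  cells := Finset.range d ×ˢ Finset.range d
  isLowerSet := by
    rintro ⟨a, b⟩ ⟨a', b'⟩ ⟨h1, h2⟩ h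
    simp only [Finset.coe_product, Finset.coe_range, Set.mem_prod, Set.mem_Iio] at h h1 h2 ⊢
    exact ⟨lt_of_le_of_lt h1 h.1, lt_of_le_of_lt h2 h.2⟩

/-- The complement `nu⁻¹ = (l^l) / nu` of a partition `nu ⊆ (l^l)`, rotated by 180 degrees so as to
be a partition again. -/
def squareCompl (l : ℕ) (nu : YoungDiagram) : YoungDiagram where
  cells := (square l).cells.filter fun c => (l - 1 - c.1, l - 1 - c.2) ∉ nu
  isLowerSet := by
    rintro ⟨a, b⟩ ⟨a', b'⟩ ⟨h1, h2⟩ h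
    simp only [Finset.coe_filter, Set.mem_ofPred_eq] at h ⊢
    refine ⟨(square l).isLowerSet ⟨h1, h2⟩ h.1, fun h' => h.2 ?_⟩
    exact nu.up_left_mem (Nat.sub_le_sub_left h1 _) (Nat.sub_le_sub_left h2 _) h'

/-- The Durfee size `d(nu)`: the largest `d` with `(d^d) ⊆ nu`. -/
noncomputable def durfee (nu : YoungDiagram) : ℕ := sSup {d | square d ≤ nu}

/-- The Durfee size `d(χ)` of a character: the largest Durfee size of its constituents. -/
noncomputable def charDurfee (χ : YoungDiagram → ℕ) : ℕ := sSup (durfee '' constituents χ)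

/-- The hook length of the box `(i, j)` of `nu`: arm length plus leg length plus `1`. -/
def hookLength (nu : YoungDiagram) (i j : ℕ) : ℕ :=
  (nu.rowLen i - (j + 1)) + (nu.colLen j - (i + 1)) + 1

/-- The principal hook length partition `hl(nu)`, with parts counted from `0` and padded with
zeros: its `i`-th part is the hook length of the box `(i, i)`. -/
def hl (nu : YoungDiagram) (i : ℕ) : ℕ := if (i, i) ∈ nu then hookLength nu i i else 0

/-- `[a] ∈ χ` and `hl(a) = hl(χ)`, where `hl(χ)` is the lexicographically largest `hl(ν)` with
`[ν] ∈ χ`. -/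
def IsMaxHook (χ : YoungDiagram → ℕ) (a : YoungDiagram) : Prop :=
  a ∈ constituents χ ∧ ∀ nu ∈ constituents χ, toLex (hl nu) ≤ toLex (hl a)

end SkewDurfee

/-! Write `β` for `λ⁻¹`, with complements taken in the square `(l^l)`. The proof transfers
everything to the product `[μ] ⊗ [β]`. Inside the square, `c(λ; μ, ν) = c(ν⁻¹; β, μ)`:
Littlewood–Richardson tableaux are hives on a triangle, and turning the triangle permutes its three
sides (`lrCoeff_rotate`). The hypotheses say that `μ₁ + β₁ ≤ l` and `l(μ) + l(β) ≤ l`, so every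
constituent `α` of the product fits in the square. Since `d(α⁻¹) = l - d(α)`, large Durfee sizes in
`[λ/μ]` are small ones in the product. There `α` contains both `μ` and `β`, whence `d(α) ≥ max(d(μ),
d(β))`.

The bound is attained by the constituents with maximal principal hooks. If `μ` and `β` are nonempty,
then `α₁ ≤ μ₁ + β₁` and `l(α) ≤ l(μ) + l(β)`, and not both are equalities. So the first hook of `α`
is at most the sum of the first hooks of `μ` and `β`, with equality exactly when one of the two
bounds is sharp and the other is missed by one. In that case removing the first row and column from
all three diagrams keeps the coefficient (`lrCoeff_strip`). By induction `hl(α) ≤ hl(μ) + hl(β)`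
lexicographically, with multiplicity one in the case of equality (`hl_of_lrCoeff_ne_zero`).
Conversely each of the `min(d(μ), d(β))` steps leaves two choices of the outer hook, which gives
`2^min` such `α` (`exists_maxHook_constituents`). Finally `hl(α) = hl(μ) + hl(β)` forces `d(α) =
max(d(μ), d(β))`, because `d` is the number of positive principal hooks. -/

namespace SkewDurfee

/-! ### Littlewood–Richardson tableaux as arrays of row counts. -/

open Finset

/-- Littlewood–Richardson arrays: `g i r` is the number of boxes in row `r` of the outer shape `a`
whose entry is at most `i`, the boxes of the inner shape `m` having entry `0`; the content is `b`. -/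
structure IsLRArray (a m b : ℕ → ℕ) (g : ℕ → ℕ → ℕ) : Prop where
  zero : ∀ r, g 0 r = m r
  mono : ∀ i r, g i r ≤ g (i + 1) r
  -- The lattice property bounds the entries of row `r` (counted from `0`) by `r + 1`.
  top : ∀ i r, r < i → g i r = a r
  strip : ∀ i r, g (i + 1) (r + 1) ≤ g i r
  -- Rearranged to avoid subtraction: the entries `i + 2` in rows up to `r` are at most as many as
  -- the entries `i + 1` in rows before `r`.
  lattice : ∀ i r, ∑ x ∈ range (r + 1), g (i + 2) x + ∑ x ∈ range r, g i x ≤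
    ∑ x ∈ range (r + 1), g (i + 1) x + ∑ x ∈ range r, g (i + 1) x
  content : ∀ i, ∃ n₀, ∀ n ≥ n₀, ∑ x ∈ range n, g (i + 1) x = ∑ x ∈ range n, g i x + b i

namespace IsLRArray

variable {a m b : ℕ → ℕ} {g : ℕ → ℕ → ℕ}

theorem monotone (h : IsLRArray a m b g) (r : ℕ) : Monotone fun i => g i r :=
  monotone_nat_of_le_succ fun i => h.mono i r

theorem le_outer (h : IsLRArray a m b g) (i r : ℕ) : g i r ≤ a r :=
  (h.monotone r (by omega : i ≤ i + r + 1)).trans (h.top (i + r + 1) r (by omega)).le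

theorem antitone (h : IsLRArray a m b g) (i : ℕ) : Antitone (g i) :=
  antitone_nat_of_succ_le fun r => (h.mono i (r + 1)).trans (h.strip i r)

theorem inner_le (h : IsLRArray a m b g) (r : ℕ) : m r ≤ a r :=
  (h.zero r).symm.le.trans (h.le_outer 0 r)

end IsLRArray

theorem lt_card_filter_range_iff {P : ℕ → Prop} [DecidablePred P] {n : ℕ}
    (hP : ∀ c c', c' ≤ c → c < n → P c → P c') {c : ℕ} (hc : c < n) :
    c < ((range n).filter P).card ↔ P c := by
  constructor
  · intro h
    by_contra hn
    have : (range n).filter P ⊆ range c := by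
      intro x hx
      rw [mem_filter, mem_range] at hx
      rw [mem_range]
      by_contra hxc
      exact hn (hP x c (by omega) hx.1 hx.2)
    have := card_le_card this
    rw [card_range] at this
    omega
  · intro h
    have : range (c + 1) ⊆ (range n).filter P := by
      intro x hx
      rw [mem_range] at hx
      rw [mem_filter, mem_range]
      exact ⟨by omega, hP c x (by omega) hc h⟩
    have := card_le_card this
    rw [card_range] at this
    omega

/-- The filling `T` of `lam / mu` has weakly increasing rows, encoded by the array `g`. -/
structure Encodes (lam mu : YoungDiagram) (T : ℕ × ℕ → ℕ) (g : ℕ → ℕ → ℕ) : Prop where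
  le : ∀ i r, g i r ≤ lam.rowLen r
  mono : ∀ i r, g i r ≤ g (i + 1) r
  zero : ∀ r, g 0 r = mu.rowLen r
  entry : ∀ i r c, c < lam.rowLen r → (T (r, c) ≤ i ↔ c < g i r)

theorem mem_skew {lam mu : YoungDiagram} {r c : ℕ} :
    (r, c) ∈ lam.cells \ mu.cells ↔ c < lam.rowLen r ∧ mu.rowLen r ≤ c := by
  rw [mem_sdiff, YoungDiagram.mem_cells, YoungDiagram.mem_cells, YoungDiagram.mem_iff_lt_rowLen,
    YoungDiagram.mem_iff_lt_rowLen, not_lt]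

/-- The number of entries `v` in the rows before row `r`. -/
def rowsCount (lam mu : YoungDiagram) (T : ℕ × ℕ → ℕ) (r v : ℕ) : ℕ :=
  ((lam.cells \ mu.cells).filter fun c => c.1 < r ∧ T c = v).card

theorem Encodes.rowsCount_add {lam mu : YoungDiagram} {T : ℕ × ℕ → ℕ} {g : ℕ → ℕ → ℕ}
    (h : Encodes lam mu T g) (r n : ℕ) :
    rowsCount lam mu T r (n + 1) + ∑ x ∈ range r, g n x = ∑ x ∈ range r, g (n + 1) x := by
  induction r with
  | zero => simp [rowsCount]
  | succ r ih =>
    have hsplit : ((lam.cells \ mu.cells).filter fun c => c.1 < r + 1 ∧ T c = n + 1) =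
        ((lam.cells \ mu.cells).filter fun c => c.1 < r ∧ T c = n + 1) ∪
          (Ico (g n r) (g (n + 1) r)).image fun c => (r, c) := by
      ext ⟨i, c⟩
      simp only [mem_filter, mem_union, mem_image, mem_Ico, mem_skew, Prod.mk.injEq]
      have hle := h.le (n + 1) r
      have h0 : mu.rowLen r ≤ g n r := by
        rw [← h.zero r]
        exact monotone_nat_of_le_succ (f := fun i => g i r) (fun i => h.mono i r) (Nat.zero_le n)
      constructor
      · rintro ⟨⟨h1, h2⟩, h3, h4⟩
        by_cases hi : i < r
        · exact Or.inl ⟨⟨h1, h2⟩, hi, h4⟩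
        · obtain rfl : i = r := by omega
          have e1 := h.entry n i c h1
          have e2 := h.entry (n + 1) i c h1
          exact Or.inr ⟨c, ⟨by by_contra; omega, by omega⟩, rfl, rfl⟩
      · rintro (⟨h1, h2, h3⟩ | ⟨c, ⟨h1, h2⟩, rfl, rfl⟩)
        · exact ⟨h1, by omega, h3⟩
        · have e1 := h.entry n r c (by omega)
          have e2 := h.entry (n + 1) r c (by omega)
          exact ⟨⟨by omega, by omega⟩, by omega, by omega⟩
    have hdisj : Disjoint ((lam.cells \ mu.cells).filter fun c => c.1 < r ∧ T c = n + 1)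
        ((Ico (g n r) (g (n + 1) r)).image fun c => (r, c)) := by
      rw [Finset.disjoint_left]
      rintro ⟨i, c⟩ h1 h2
      simp only [mem_filter, mem_image, Prod.mk.injEq] at h1 h2
      obtain ⟨_, _, h3, _⟩ := h2
      omega
    rw [rowsCount, hsplit, card_union_of_disjoint hdisj, card_image_of_injective _
      (Prod.mk_right_injective r), Nat.card_Ico, sum_range_succ, sum_range_succ, ← ih, rowsCount]
    have := h.mono n r
    omega

theorem rowsCount_le_succ (lam mu : YoungDiagram) (T : ℕ × ℕ → ℕ) (r v : ℕ) :
    rowsCount lam mu T r v ≤ rowsCount lam mu T (r + 1) v :=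
  card_le_card fun c hc => by
    rw [mem_filter] at hc ⊢
    exact ⟨hc.1, by omega, hc.2.2⟩

theorem rowsCount_eq_content {lam mu : YoungDiagram} {T : ℕ × ℕ → ℕ} {r : ℕ}
    (hr : lam.colLen 0 ≤ r) (v : ℕ) :
    rowsCount lam mu T r v = ((lam.cells \ mu.cells).filter fun c => T c = v).card := by
  rw [rowsCount]
  congr 1
  ext ⟨i, j⟩
  simp only [mem_filter, and_congr_right_iff, and_iff_right_iff_imp]
  intro h _
  rw [mem_sdiff, YoungDiagram.mem_cells] at h
  have := YoungDiagram.mem_iff_lt_colLen.1 (lam.up_left_mem le_rfl (Nat.zero_le j) h.1)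
  omega

/-- The array of a filling. -/
def arrayOf (lam : YoungDiagram) (T : ℕ × ℕ → ℕ) (i r : ℕ) : ℕ :=
  ((range (lam.rowLen r)).filter fun c => T (r, c) ≤ i).card

/-- The filling of an array. -/
def fillingOf (lam : YoungDiagram) (g : ℕ → ℕ → ℕ) (c : ℕ × ℕ) : ℕ :=
  if c.2 < lam.rowLen c.1 then ((range (c.1 + 1)).filter fun i => g i c.1 ≤ c.2).card else 0

section Tableau

variable {lam mu nu : YoungDiagram} {T : ℕ × ℕ → ℕ}

theorem IsLRTableau.encodes (h : IsLRTableau lam mu nu T) : Encodes lam mu T (arrayOf lam T) where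
  le i r := (card_filter_le _ _).trans (card_range _).le
  mono i r := card_le_card fun c hc => by
    rw [mem_filter] at hc ⊢
    exact ⟨hc.1, by omega⟩
  zero r := by
    have hsub : mu.rowLen r ≤ lam.rowLen r := by
      by_contra hlt
      have h1 : (r, lam.rowLen r) ∈ mu := YoungDiagram.mem_iff_lt_rowLen.2 (by omega)
      have h2 := YoungDiagram.mem_iff_lt_rowLen.1 (h.subset h1)
      omega
    have : ((range (lam.rowLen r)).filter fun c => T (r, c) ≤ 0) = range (mu.rowLen r) := by
      ext c
      rw [mem_filter, mem_range, mem_range]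
      constructor
      · rintro ⟨h1, h2⟩
        by_contra h3
        have := h.pos (r, c) (mem_skew.2 ⟨h1, by omega⟩)
        omega
      · intro h1
        refine ⟨by omega, (h.zero (r, c) fun h2 => ?_).le⟩
        have := (mem_skew.1 h2).2
        omega
    rw [arrayOf, this, card_range]
  entry i r c hc := by
    rw [arrayOf, lt_card_filter_range_iff _ hc]
    intro c c' hcc hc h1
    by_cases h2 : (r, c') ∈ lam.cells \ mu.cells
    · rcases hcc.lt_or_eq with h3 | rfl
      · have h4 : (r, c) ∈ lam.cells \ mu.cells :=
          mem_skew.2 ⟨hc, (mem_skew.1 h2).2.trans hcc⟩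
        exact (h.row_weak r c' c h3 h2 h4).trans h1
      · exact h1
    · rw [h.zero _ h2]
      exact Nat.zero_le _

/-- The lattice condition compares counts only at boxes of the shape. If row `r` contains `i + 2`,
it is applied at the leftmost such box; otherwise the inequality is inherited from the previous row.
-/
theorem IsLRTableau.rowsCount_le (h : IsLRTableau lam mu nu T) (r i : ℕ) :
    rowsCount lam mu T (r + 1) (i + 2) ≤ rowsCount lam mu T r (i + 1) := by
  have he := h.encodes
  induction r with
  | zero =>
    have h1 := he.rowsCount_add 1 (i + 1)
    simp only [sum_range_one] at h1
    by_cases hlt : arrayOf lam T (i + 1) 0 < arrayOf lam T (i + 2) 0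
    · exact aux he 0 hlt
    · have := he.mono (i + 1) 0
      simp only [zero_add] at *
      rw [show i + 1 + 1 = i + 2 from rfl] at *
      omega
  | succ r ih =>
    by_cases hlt : arrayOf lam T (i + 1) (r + 1) < arrayOf lam T (i + 2) (r + 1)
    · exact aux he (r + 1) hlt
    · have h1 := he.rowsCount_add (r + 1 + 1) (i + 1)
      have h2 := he.rowsCount_add (r + 1) (i + 1)
      rw [sum_range_succ, sum_range_succ _ (r + 1)] at h1
      have := he.mono (i + 1) (r + 1)
      have := rowsCount_le_succ lam mu T r (i + 1)
      have e : i + 1 + 1 = i + 2 := rfl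
      rw [e] at *
      omega
where
  aux (he : Encodes lam mu T (arrayOf lam T)) (r : ℕ)
      (hlt : arrayOf lam T (i + 1) r < arrayOf lam T (i + 2) r) :
      rowsCount lam mu T (r + 1) (i + 2) ≤ rowsCount lam mu T r (i + 1) := by
    -- Column of the leftmost `i + 2` in row `r`: the word up to this box has read every `i + 2` of
    -- the row and none of its `i + 1`.
    set j := arrayOf lam T (i + 1) r with hj
    have hle := he.le (i + 2) r
    have hmu : mu.rowLen r ≤ j := by
      rw [← he.zero r]
      exact monotone_nat_of_le_succ (f := fun i => arrayOf lam T i r) (fun i => he.mono i r)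
        (Nat.zero_le (i + 1))
    have hb : (r, j) ∈ lam.cells \ mu.cells := mem_skew.2 ⟨by omega, hmu⟩
    have key := h.lattice (r, j) hb (i + 1) (by omega)
    refine le_trans (card_le_card ?_) (key.trans (card_le_card ?_))
    · rintro ⟨x, y⟩ hx
      simp only [mem_filter] at hx ⊢
      refine ⟨hx.1, ?_, hx.2.2⟩
      by_cases hxr : x < r
      · exact Or.inl hxr
      · obtain rfl : x = r := by omega
        have := he.entry (i + 1) x y (mem_skew.1 hx.1).1
        exact Or.inr ⟨rfl, by omega⟩
    · rintro ⟨x, y⟩ hx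
      simp only [mem_filter] at hx ⊢
      refine ⟨hx.1, ?_, hx.2.2⟩
      rcases hx.2.1 with h1 | ⟨rfl, h1⟩
      · exact h1
      · have := he.entry (i + 1) x y (mem_skew.1 hx.1).1
        omega

theorem IsLRTableau.rowsCount_eq_zero (h : IsLRTableau lam mu nu T) (r v : ℕ) (hv : r < v) :
    rowsCount lam mu T r v = 0 := by
  induction r generalizing v with
  | zero => simp [rowsCount]
  | succ r ih =>
    obtain ⟨i, rfl⟩ : ∃ i, v = i + 2 := ⟨v - 2, by omega⟩
    exact Nat.le_zero.1 ((h.rowsCount_le r i).trans (ih (i + 1) (by omega)).le)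

theorem IsLRTableau.isLRArray (h : IsLRTableau lam mu nu T) :
    IsLRArray lam.rowLen mu.rowLen nu.rowLen (arrayOf lam T) where
  zero := h.encodes.zero
  mono := h.encodes.mono
  top i r hri := by
    rw [arrayOf, filter_true_of_mem, card_range]
    intro c hc
    rw [mem_range] at hc
    by_contra hlt
    by_cases hskew : (r, c) ∈ lam.cells \ mu.cells
    · have h0 := h.rowsCount_eq_zero (r + 1) (T (r, c)) (by omega)
      rw [rowsCount, card_eq_zero] at h0
      have : (r, c) ∈ ((lam.cells \ mu.cells).filter fun x => x.1 < r + 1 ∧ T x = T (r, c)) :=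
        mem_filter.2 ⟨hskew, by simp⟩
      rw [h0] at this
      exact notMem_empty _ this
    · rw [h.zero _ hskew] at hlt
      omega
  strip i r := by
    by_contra! hlt
    set c := arrayOf lam T i r
    have h1 : c < lam.rowLen (r + 1) := hlt.trans_le (h.encodes.le _ _)
    have h2 : c < lam.rowLen r := h1.trans_le (lam.rowLen_anti r (r + 1) (by omega))
    have h3 := (h.encodes.entry (i + 1) (r + 1) c h1).2 hlt
    have h4 := (h.encodes.entry i r c h2).not.2 (lt_irrefl _)
    by_cases h5 : (r, c) ∈ lam.cells \ mu.cells
    · have h6 : (r + 1, c) ∈ lam.cells \ mu.cells :=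
        mem_skew.2 ⟨h1, (mu.rowLen_anti r (r + 1) (by omega)).trans (mem_skew.1 h5).2⟩
      have := h.col_strict r (r + 1) c (by omega) h5 h6
      omega
    · rw [h.zero _ h5] at h4
      omega
  lattice i r := by
    have h1 := h.encodes.rowsCount_add (r + 1) (i + 1)
    have h2 := h.encodes.rowsCount_add r i
    have h3 := h.rowsCount_le r i
    rw [show i + 1 + 1 = i + 2 from rfl] at h1
    omega
  content i := ⟨lam.colLen 0, fun n hn => by
    rw [← h.encodes.rowsCount_add n i, rowsCount_eq_content hn, h.content, add_comm]⟩

variable {g : ℕ → ℕ → ℕ}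

theorem IsLRArray.encodes (h : IsLRArray lam.rowLen mu.rowLen nu.rowLen g) :
    Encodes lam mu (fillingOf lam g) g where
  le := h.le_outer
  mono := h.mono
  zero := h.zero
  entry i r c hc := by
    simp only [fillingOf, if_pos hc]
    -- `fillingOf` only looks at `i ≤ r`; by `top`, larger `i` contribute nothing.
    by_cases hi : i < r + 1
    · rw [← not_lt, lt_card_filter_range_iff _ hi, not_le]
      intro i i' hi' _ hg
      exact (h.monotone r hi').trans hg
    · rw [h.top i r (by omega)]
      refine iff_of_true ?_ hc
      exact ((card_filter_le _ _).trans (card_range _).le).trans (by omega)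

theorem IsLRArray.arrayOf_fillingOf (h : IsLRArray lam.rowLen mu.rowLen nu.rowLen g) :
    arrayOf lam (fillingOf lam g) = g := by
  funext i r
  have : ((range (lam.rowLen r)).filter fun c => fillingOf lam g (r, c) ≤ i) = range (g i r) := by
    ext c
    rw [mem_filter, mem_range, mem_range]
    constructor
    · rintro ⟨h1, h2⟩
      exact (h.encodes.entry i r c h1).1 h2
    · intro h1
      have h2 := h1.trans_le (h.le_outer i r)
      exact ⟨h2, (h.encodes.entry i r c h2).2 h1⟩
  rw [arrayOf, this, card_range]

theorem IsLRTableau.fillingOf_arrayOf (h : IsLRTableau lam mu nu T) :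
    fillingOf lam (arrayOf lam T) = T := by
  funext ⟨r, c⟩
  by_cases hc : c < lam.rowLen r
  · have h1 := h.isLRArray.encodes.entry (T (r, c)) r c hc
    have h2 := h.encodes.entry (fillingOf lam (arrayOf lam T) (r, c)) r c hc
    have h3 := h.isLRArray.encodes.entry (fillingOf lam (arrayOf lam T) (r, c)) r c hc
    have h4 := h.encodes.entry (T (r, c)) r c hc
    exact le_antisymm (h1.2 (h4.1 le_rfl)) (h2.2 (h3.1 le_rfl))
  · rw [h.zero _ fun h1 => hc (mem_skew.1 h1).1]
    simp [fillingOf, hc]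

theorem IsLRArray.isLRTableau (h : IsLRArray lam.rowLen mu.rowLen nu.rowLen g) :
    IsLRTableau lam mu nu (fillingOf lam g) where
  subset := by
    rintro ⟨r, c⟩ hc
    exact YoungDiagram.mem_iff_lt_rowLen.2
      ((YoungDiagram.mem_iff_lt_rowLen.1 hc).trans_le (h.inner_le r))
  pos := by
    rintro ⟨r, c⟩ hc
    obtain ⟨h1, h2⟩ := mem_skew.1 hc
    have := h.encodes.entry 0 r c h1
    rw [h.zero] at this
    omega
  zero := by
    rintro ⟨r, c⟩ hc
    rw [mem_skew, not_and] at hc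
    by_cases h1 : c < lam.rowLen r
    · have := h.encodes.entry 0 r c h1
      have := hc h1
      rw [h.zero] at *
      omega
    · simp [fillingOf, h1]
  row_weak i j₁ j₂ hj h1 h2 := by
    have e1 := h.encodes.entry (fillingOf lam g (i, j₂)) i j₁ (mem_skew.1 h1).1
    have e2 := h.encodes.entry (fillingOf lam g (i, j₂)) i j₂ (mem_skew.1 h2).1
    omega
  col_strict i₁ i₂ j hi h1 h2 := by
    have e0 := h.encodes.entry 0 i₂ j (mem_skew.1 h2).1
    have h3 := (mem_skew.1 h2).2
    rw [h.zero] at e0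
    obtain ⟨v, hv⟩ : ∃ v, fillingOf lam g (i₂, j) = v + 1 :=
      ⟨fillingOf lam g (i₂, j) - 1, by omega⟩
    have e1 := h.encodes.entry v i₁ j (mem_skew.1 h1).1
    have e2 := h.encodes.entry (v + 1) i₂ j (mem_skew.1 h2).1
    obtain ⟨i, rfl⟩ : ∃ i, i₂ = i + 1 := ⟨i₂ - 1, by omega⟩
    have := h.strip v i
    have := h.antitone v (by omega : i₁ ≤ i)
    omega
  content n := by
    obtain ⟨n₀, hn₀⟩ := h.content n
    have h1 := hn₀ (max n₀ (lam.colLen 0)) (le_max_left _ _)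
    have h2 := h.encodes.rowsCount_add (max n₀ (lam.colLen 0)) n
    rw [rowsCount_eq_content (le_max_right _ _)] at h2
    omega
  lattice := by
    rintro ⟨r, j⟩ _ n hn
    obtain ⟨i, rfl⟩ : ∃ i, n = i + 1 := ⟨n - 1, by omega⟩
    have h1 := h.encodes.rowsCount_add (r + 1) (i + 1)
    have h2 := h.encodes.rowsCount_add r i
    have h3 := h.lattice i r
    rw [show i + 1 + 1 = i + 2 from rfl] at *
    -- An initial segment ending in row `r` lies between the rows before `r` and the rows up to `r`,
    -- so the row-wise inequality suffices.
    refine le_trans (card_le_card ?_) ((by omega : rowsCount lam mu (fillingOf lam g) (r + 1) (i + 2)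
      ≤ rowsCount lam mu (fillingOf lam g) r (i + 1)).trans (card_le_card ?_))
    · intro c hc
      rw [mem_filter] at hc ⊢
      exact ⟨hc.1, by omega, hc.2.2⟩
    · intro c hc
      rw [mem_filter] at hc ⊢
      exact ⟨hc.1, Or.inl hc.2.1, hc.2.2⟩

end Tableau

theorem ncard_eq_of_invOn {α β : Type*} {s : Set α} {t : Set β} {f : α → β} {f' : β → α}
    (hf : ∀ x ∈ s, f x ∈ t) (hf' : ∀ y ∈ t, f' y ∈ s) (h : ∀ x ∈ s, f' (f x) = x)
    (h' : ∀ y ∈ t, f (f' y) = y) : s.ncard = t.ncard :=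
  (Set.InvOn.bijOn ⟨h, h'⟩ hf hf').ncard_eq

/-- The number of Littlewood–Richardson arrays. -/
noncomputable def arrayCount (a m b : ℕ → ℕ) : ℕ := {g | IsLRArray a m b g}.ncard

theorem lrCoeff_eq_arrayCount (lam mu nu : YoungDiagram) :
    lrCoeff lam mu nu = arrayCount lam.rowLen mu.rowLen nu.rowLen :=
  ncard_eq_of_invOn (f := arrayOf lam) (f' := fillingOf lam)
    (fun _ h => IsLRTableau.isLRArray h) (fun _ h => IsLRArray.isLRTableau h)
    (fun _ h => IsLRTableau.fillingOf_arrayOf h) (fun _ h => IsLRArray.arrayOf_fillingOf h)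

end SkewDurfee

/-! ### Bounds on the outer shape; removing a first row or column of maximal length. -/

namespace SkewDurfee

open Finset

namespace IsLRArray

variable {a m b : ℕ → ℕ} {g : ℕ → ℕ → ℕ}

theorem eq_of_content_eq_zero (h : IsLRArray a m b g) {i : ℕ} (hi : b i = 0) (r : ℕ) :
    g (i + 1) r = g i r := by
  obtain ⟨n₀, hn₀⟩ := h.content i
  have h1 := hn₀ (max n₀ (r + 1)) (le_max_left _ _)
  rw [hi, add_zero] at h1
  exact ((sum_eq_sum_iff_of_le fun x _ => h.mono i x).1 h1.symm r
    (mem_range.2 (by omega))).symm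

theorem eq_outer_of_content_eq_zero (h : IsLRArray a m b g) {i : ℕ} (hb : ∀ j ≥ i, b j = 0)
    (r : ℕ) : g i r = a r := by
  have key : ∀ k, g (i + k) r = g i r := by
    intro k
    induction k with
    | zero => rfl
    | succ k ih => rw [← ih, ← add_assoc, h.eq_of_content_eq_zero (hb (i + k) (by omega))]
  rw [← key (r + 1), h.top _ _ (by omega)]

theorem sum_succ_eq (h : IsLRArray a m b g) (i : ℕ) : ∃ n₀, ∀ n ≥ n₀, ∀ k ≤ n,
    ∑ x ∈ range k, (g (i + 1) x - g i x) + ∑ x ∈ Ico k n, (g (i + 1) x - g i x) = b i := by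
  obtain ⟨n₀, hn₀⟩ := h.content i
  refine ⟨n₀, fun n hn k hk => ?_⟩
  have h1 := hn₀ n hn
  rw [sum_range_add_sum_Ico _ hk]
  have h2 : ∑ x ∈ range n, (g (i + 1) x - g i x) + ∑ x ∈ range n, g i x =
      ∑ x ∈ range n, g (i + 1) x := by
    rw [← sum_add_distrib]
    exact sum_congr rfl fun x _ => Nat.sub_add_cancel (h.mono i x)
  omega

theorem outer_zero_le (h : IsLRArray a m b g) : a 0 ≤ m 0 + b 0 := by
  obtain ⟨n₀, hn₀⟩ := h.sum_succ_eq 0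
  have h1 := hn₀ (n₀ + 1) (by omega) 1 (by omega)
  rw [sum_range_one, zero_add, h.top 1 0 one_pos, h.zero] at h1
  omega

theorem first_row (h : IsLRArray a m b g) (h0 : a 0 = m 0 + b 0) (r : ℕ) :
    g 1 (r + 1) = m (r + 1) := by
  obtain ⟨n₀, hn₀⟩ := h.sum_succ_eq 0
  have h1 := hn₀ (n₀ + r + 2) (by omega) 1 (by omega)
  rw [sum_range_one, zero_add, h.top 1 0 one_pos, h.zero] at h1
  have h2 : ∑ x ∈ Ico 1 (n₀ + r + 2), (g 1 x - g 0 x) = 0 := by omega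
  have h3 := sum_eq_zero_iff.1 h2 (r + 1) (mem_Ico.2 (by omega))
  have h4 := h.mono 0 (r + 1)
  rw [h.zero] at h3 h4
  rw [zero_add] at h4
  omega

/-- The boxes with entry `i + 1` form a horizontal strip and avoid the rows before `i`, so they
occupy distinct columns of row `i`. -/
theorem content_le_outer (h : IsLRArray a m b g) (i : ℕ) : b i ≤ a i := by
  obtain ⟨n₀, hn₀⟩ := h.sum_succ_eq i
  have h1 := hn₀ (n₀ + i) (by omega) i (by omega)
  have h2 : ∑ x ∈ range i, (g (i + 1) x - g i x) = 0 := by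
    refine sum_eq_zero fun x hx => ?_
    rw [mem_range] at hx
    rw [h.top i x hx, h.top (i + 1) x (by omega), Nat.sub_self]
  -- Telescoping along the strip condition.
  have h3 : ∀ n ≥ i, ∑ x ∈ Ico i n, (g (i + 1) x - g i x) + g (i + 1) n ≤ g (i + 1) i := by
    intro n hn
    induction n, hn using Nat.le_induction with
    | base => simp
    | succ n hn ih =>
      rw [sum_Ico_succ_top hn]
      have := h.strip i n
      have := h.mono i n
      omega
  have h4 := h3 (n₀ + i) (by omega)
  have h5 := h.le_outer (i + 1) i
  omega

/-- Each letter extends a column by at most one box. -/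
theorem eq_zero_of_le (h : IsLRArray a m b g) {lm : ℕ} (hm : ∀ r, lm ≤ r → m r = 0) (i r : ℕ)
    (hr : lm + i ≤ r) : g i r = 0 := by
  induction i generalizing r with
  | zero => rw [h.zero, hm r (by omega)]
  | succ i ih =>
    obtain ⟨r, rfl⟩ : ∃ s, r = s + 1 := ⟨r - 1, by omega⟩
    exact Nat.le_zero.1 ((h.strip i r).trans (ih r (by omega)).le)

theorem outer_eq_zero (h : IsLRArray a m b g) {lm lb : ℕ} (hm : ∀ r, lm ≤ r → m r = 0)
    (hb : ∀ r, lb ≤ r → b r = 0) (r : ℕ) (hr : lm + lb ≤ r) : a r = 0 := by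
  rw [← h.eq_outer_of_content_eq_zero hb r, h.eq_zero_of_le hm lb r hr]

theorem strip_iterate (h : IsLRArray a m b g) (i r k : ℕ) : g (i + k) (r + k) ≤ g i r := by
  induction k with
  | zero => rfl
  | succ k ih => exact (h.strip (i + k) (r + k)).trans ih

/-- If the first row has maximal length, then the number of rows is not maximal. -/
theorem outer_eq_zero_of_first_row (h : IsLRArray a m b g) {lm lb : ℕ}
    (hm : ∀ r, lm ≤ r → m r = 0) (hb : ∀ r, lb ≤ r → b r = 0) (h0 : a 0 = m 0 + b 0)
    (hlm : 0 < lm) (hlb : 0 < lb) : a (lm + lb - 1) = 0 := by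
  -- All entries `1` lie in row `0`, so the letter `1` opens no new row and the remaining `lb - 1`
  -- letters open at most `lb - 1`.
  have h1 : g 1 lm = 0 := by
    obtain ⟨k, rfl⟩ : ∃ k, lm = k + 1 := ⟨lm - 1, by omega⟩
    rw [h.first_row h0, hm _ le_rfl]
  have h2 := h.strip_iterate 1 lm (lb - 1)
  rw [show 1 + (lb - 1) = lb by omega, h.eq_outer_of_content_eq_zero hb, h1] at h2
  rw [show lm + lb - 1 = lm + (lb - 1) by omega]
  omega

/-- The first row absorbs every `1`. Deleting it and lowering all other entries by one leaves a
tableau whose content has lost its first part. -/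
theorem removeRow (h : IsLRArray a m b g) (h0 : a 0 = m 0 + b 0) :
    IsLRArray (fun r => a (r + 1)) (fun r => m (r + 1)) (fun r => b (r + 1))
      (fun i r => g (i + 1) (r + 1)) where
  zero r := h.first_row h0 r
  mono i r := h.mono _ _
  top i r hir := h.top _ _ (by omega)
  strip i r := h.strip _ _
  lattice i r := by
    have h1 := h.lattice (i + 1) (r + 1)
    simp only [sum_range_succ' _ (r + 1), sum_range_succ' _ r, h.top (i + 1 + 2) 0 (by omega),
      h.top (i + 1 + 1) 0 (by omega), h.top (i + 1) 0 (by omega)] at h1 ⊢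
    simp only [show i + 1 + 2 = i + 2 + 1 from rfl] at h1 ⊢
    omega
  content i := by
    obtain ⟨n₀, hn₀⟩ := h.content (i + 1)
    refine ⟨n₀, fun n hn => ?_⟩
    have h1 := hn₀ (n + 1) (by omega)
    simp only [sum_range_succ', h.top (i + 1 + 1) 0 (by omega), h.top (i + 1) 0 (by omega)] at h1
    omega

end IsLRArray

variable {a m b : ℕ → ℕ}

/-- The array with a first row of maximal length added. -/
def addRow (a m : ℕ → ℕ) (h : ℕ → ℕ → ℕ) : ℕ → ℕ → ℕ
  | 0, r => m r
  | _ + 1, 0 => a 0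
  | i + 1, r + 1 => h i r

theorem isLRArray_addRow {h : ℕ → ℕ → ℕ} (ha : Antitone a) (hm : Antitone m) (hb : Antitone b)
    (h0 : a 0 = m 0 + b 0)
    (hh : IsLRArray (fun r => a (r + 1)) (fun r => m (r + 1)) (fun r => b (r + 1)) h) :
    IsLRArray a m b (addRow a m h) where
  zero r := rfl
  mono i r := by
    rcases i with _ | i <;> rcases r with _ | r
    · simp only [addRow]; omega
    · exact (hh.zero r).symm.le
    · exact le_rfl
    · exact hh.mono i r
  top i r hir := by
    rcases i with _ | i
    · omega
    · rcases r with _ | r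
      · rfl
      · exact hh.top i r (by omega)
  strip i r := by
    rcases i with _ | i
    · exact (hh.zero r).le.trans (hm (Nat.le_succ r))
    · rcases r with _ | r
      · exact (hh.le_outer (i + 1) 0).trans (ha (Nat.zero_le 1))
      · exact hh.strip i r
  lattice i r := by
    rcases r with _ | r
    · simp [addRow]
    rcases i with _ | i
    -- The only new lattice condition compares the letters `1` and `2`: there are at most `b 1 ≤ b
    -- 0` twos, and all `b 0` ones are in row `0`.
    · have h1 : ∀ n, ∑ x ∈ range n, h 1 x ≤ ∑ x ∈ range n, h 0 x + b 1 := by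
        intro n
        obtain ⟨n₀, hn₀⟩ := hh.sum_succ_eq 0
        have h1 := hn₀ (n₀ + n) (by omega) n (by omega)
        have h2 : ∑ x ∈ range n, (h 1 x - h 0 x) + ∑ x ∈ range n, h 0 x =
            ∑ x ∈ range n, h 1 x := by
          rw [← sum_add_distrib]
          exact sum_congr rfl fun x _ => Nat.sub_add_cancel (hh.mono 0 x)
        simp only [zero_add] at h1
        omega
      have h2 := h1 (r + 1)
      have h3 := hb (Nat.zero_le 1)
      have h4 : ∀ n, ∑ x ∈ range n, h 0 x = ∑ x ∈ range n, m (x + 1) :=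
        fun n => sum_congr rfl fun x _ => hh.zero x
      simp only [sum_range_succ' _ (r + 1), sum_range_succ' _ r, addRow, h4] at h2 ⊢
      omega
    · have h1 := hh.lattice i r
      simp only [sum_range_succ' _ (r + 1), sum_range_succ' _ r, addRow] at h1 ⊢
      omega
  content i := by
    rcases i with _ | i
    · refine ⟨1, fun n hn => ?_⟩
      obtain ⟨n, rfl⟩ : ∃ s, n = s + 1 := ⟨n - 1, by omega⟩
      simp only [sum_range_succ', addRow, hh.zero]
      omega
    · obtain ⟨n₀, hn₀⟩ := hh.content i
      refine ⟨n₀ + 1, fun n hn => ?_⟩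
      obtain ⟨n, rfl⟩ : ∃ s, n = s + 1 := ⟨n - 1, by omega⟩
      have := hn₀ n (by omega)
      simp only [sum_range_succ', addRow]
      omega

/-- Removing a first row of maximal length. -/
theorem arrayCount_removeRow (ha : Antitone a) (hm : Antitone m) (hb : Antitone b)
    (h0 : a 0 = m 0 + b 0) :
    arrayCount a m b = arrayCount (fun r => a (r + 1)) (fun r => m (r + 1)) (fun r => b (r + 1)) :=
  ncard_eq_of_invOn (f := fun g i r => g (i + 1) (r + 1)) (f' := addRow a m)
    (fun _ h => IsLRArray.removeRow h h0) (fun _ h => isLRArray_addRow ha hm hb h0 h)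
    (fun g h => by
      have h : IsLRArray a m b g := h
      funext i r
      rcases i with _ | i
      · exact (h.zero r).symm
      · rcases r with _ | r
        · exact (h.top (i + 1) 0 (by omega)).symm
        · rfl)
    (fun _ _ => rfl)

theorem sum_range_ite_lt (n k : ℕ) : ∑ x ∈ range n, (if x < k then 1 else 0) = min n k := by
  induction n with
  | zero => simp
  | succ n ih =>
    rw [sum_range_succ, ih]
    split_ifs <;> omega

section Column

variable {lm lb : ℕ} {g h : ℕ → ℕ → ℕ}

/-- Adding a first column with `lm + lb` boxes, of which `lm` are inner boxes. -/
theorem isLRArray_iff_of_column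
    (ha : ∀ r, 0 < a r ↔ r < lm + lb) (hm : ∀ r, 0 < m r ↔ r < lm) (hb : ∀ r, 0 < b r ↔ r < lb)
    -- Below its `lm` inner boxes the added column reads `1, …, lb`, so its box in row `r` has entry
    -- at most `i` exactly if `r < lm + min i lb`.
    (hgh : ∀ i r, (r < lm + min i lb ∧ g i r = h i r + 1) ∨
      (lm + min i lb ≤ r ∧ g i r = 0 ∧ h i r = 0)) :
    IsLRArray a m b g ↔
      IsLRArray (fun r => a r - 1) (fun r => m r - 1) (fun r => b r - 1) h := by
  have hs : ∀ i n, ∑ x ∈ range n, g i x = ∑ x ∈ range n, h i x + min n (lm + min i lb) := by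
    intro i n
    rw [← sum_range_ite_lt, ← sum_add_distrib]
    refine sum_congr rfl fun x _ => ?_
    have := hgh i x
    split_ifs <;> omega
  constructor
  · intro H
    have hmono : ∀ i r, h i r ≤ h (i + 1) r := fun i r => by
      have := H.mono i r
      have := hgh i r
      have := hgh (i + 1) r
      omega
    refine ⟨fun r => ?_, hmono, fun i r hir => ?_, fun i r => ?_, fun i r => ?_, fun i => ?_⟩
    · have := H.zero r
      have := hgh 0 r
      have := hm r
      omega
    · have := H.top i r hir
      have := hgh i r
      have := ha r
      omega
    · have := H.strip i r
      have := hgh i r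
      have := hgh (i + 1) (r + 1)
      omega
    -- The column contributes equally to both sides, as its `i + 2` lies directly below its `i + 1`.
    -- If `i + 2 > lb`, the letter `i + 2` does not occur.
    · by_cases hi : i + 2 ≤ lb
      · have := H.lattice i r
        simp only [hs] at this
        omega
      · have hb1 : b (i + 1) = 0 := by
          have := hb (i + 1)
          omega
        refine add_le_add (sum_le_sum fun x _ => ?_) (sum_le_sum fun x _ => hmono i x)
        have := H.eq_of_content_eq_zero hb1 x
        have := hgh (i + 1) x
        have := hgh (i + 2) x
        have e : i + 1 + 1 = i + 2 := rfl
        rw [e] at *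
        omega
    · obtain ⟨n₀, hn₀⟩ := H.content i
      refine ⟨n₀ + lm + lb, fun n hn => ?_⟩
      have := hn₀ n (by omega)
      simp only [hs] at this
      have := hb i
      omega
  · intro H
    have hmono : ∀ i r, g i r ≤ g (i + 1) r := fun i r => by
      have := H.mono i r
      have := hgh i r
      have := hgh (i + 1) r
      omega
    refine ⟨fun r => ?_, hmono, fun i r hir => ?_, fun i r => ?_, fun i r => ?_, fun i => ?_⟩
    · have := H.zero r
      have := hgh 0 r
      have := hm r
      omega
    · have := H.top i r hir
      have := hgh i r
      have := ha r
      omega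
    · have := H.strip i r
      have := hgh i r
      have := hgh (i + 1) (r + 1)
      omega
    · by_cases hi : i + 2 ≤ lb
      · have := H.lattice i r
        simp only [hs]
        omega
      · have hb1 : b (i + 1) - 1 = 0 := by
          have := hb (i + 1)
          omega
        refine add_le_add (sum_le_sum fun x _ => ?_) (sum_le_sum fun x _ => hmono i x)
        have := H.eq_of_content_eq_zero (i := i + 1) hb1 x
        have := hgh (i + 1) x
        have := hgh (i + 2) x
        have e : i + 1 + 1 = i + 2 := rfl
        rw [e] at *
        omega
    · obtain ⟨n₀, hn₀⟩ := H.content i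
      refine ⟨n₀ + lm + lb, fun n hn => ?_⟩
      have := hn₀ n (by omega)
      simp only [hs]
      have := hb i
      omega

/-- Removing a first column of maximal length. -/
theorem arrayCount_removeColumn
    (ha : ∀ r, 0 < a r ↔ r < lm + lb) (hm : ∀ r, 0 < m r ↔ r < lm) (hb : ∀ r, 0 < b r ↔ r < lb) :
    arrayCount a m b = arrayCount (fun r => a r - 1) (fun r => m r - 1) (fun r => b r - 1) := by
  have hm0 : ∀ r, lm ≤ r → m r = 0 := fun r hr => by
    have := hm r
    omega
  have hb0 : ∀ r, lb ≤ r → b r = 0 := fun r hr => by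
    have := hb r
    omega
  have hg : ∀ g, IsLRArray a m b g → ∀ i r,
      (r < lm + min i lb ∧ 0 < g i r) ∨ (lm + min i lb ≤ r ∧ g i r = 0) := by
    intro g H i r
    by_cases hr : r < lm + min i lb
    · refine Or.inl ⟨hr, ?_⟩
      by_cases hi : i ≤ lb
      -- Only `lb - i` letters remain for the rest of the column, so a column of full length `lm +
      -- lb` forces this box to be filled by now.
      · have h1 := H.strip_iterate i r (lb - i)
        rw [show i + (lb - i) = lb by omega, H.eq_outer_of_content_eq_zero hb0] at h1
        exact ((ha _).2 (by omega)).trans_le h1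
      · rw [H.eq_outer_of_content_eq_zero fun j hj => hb0 j (by omega)]
        exact (ha r).2 (by omega)
    · refine Or.inr ⟨by omega, ?_⟩
      by_cases hi : i ≤ lb
      · exact H.eq_zero_of_le hm0 i r (by omega)
      · have := (ha r).not.2 (by omega)
        have := H.le_outer i r
        omega
  have hh : ∀ h, IsLRArray (fun r => a r - 1) (fun r => m r - 1) (fun r => b r - 1) h →
      ∀ i r, lm + min i lb ≤ r → h i r = 0 := by
    intro h H i r hr
    by_cases hi : i ≤ lb
    · exact H.eq_zero_of_le (lm := lm) (fun r hr => by rw [hm0 r hr]) i r (by omega)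
    · have := (ha r).not.2 (by omega)
      have := H.le_outer i r
      omega
  refine ncard_eq_of_invOn (f := fun g i r => g i r - 1)
    (f' := fun h i r => if r < lm + min i lb then h i r + 1 else 0) ?_ ?_ ?_ ?_
  · intro g H
    refine (isLRArray_iff_of_column ha hm hb fun i r => ?_).1 H
    rcases hg g H i r with ⟨h1, h2⟩ | ⟨h1, h2⟩
    · exact Or.inl ⟨h1, (Nat.sub_add_cancel h2).symm⟩
    · exact Or.inr ⟨h1, h2, by rw [h2]⟩
  · intro h H
    refine (isLRArray_iff_of_column ha hm hb fun i r => ?_).2 H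
    have := hh h H i r
    split_ifs <;> omega
  · intro g H
    funext i r
    rcases hg g H i r with ⟨h1, h2⟩ | ⟨h1, h2⟩
    · rw [if_pos h1, Nat.sub_add_cancel h2]
    · rw [if_neg h1.not_gt, h2]
  · intro h H
    funext i r
    have := hh h H i r
    simp only
    split_ifs <;> omega

end Column

section Trivial

theorem arrayCount_right_zero {f : ℕ → ℕ} (hf : Antitone f) : arrayCount f f 0 = 1 := by
  rw [arrayCount, Set.ncard_eq_one]
  refine ⟨fun _ => f, Set.eq_singleton_iff_unique_mem.2 ⟨?_, ?_⟩⟩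
  · refine ⟨fun _ => rfl, fun _ _ => le_rfl, fun _ _ _ => rfl, fun _ r => hf (Nat.le_succ r),
      fun _ _ => le_rfl, fun _ => ⟨0, fun _ _ => rfl⟩⟩
  · intro g (H : IsLRArray f f 0 g)
    funext i r
    exact H.eq_outer_of_content_eq_zero (fun _ _ => rfl) r

theorem IsLRArray.outer_eq_inner {g : ℕ → ℕ → ℕ} (H : IsLRArray a m 0 g) : a = m := by
  funext r
  rw [← H.zero, H.eq_outer_of_content_eq_zero fun _ _ => rfl]

/-- With empty inner shape, column strictness bounds the entries of row `r` below by `r + 1`, and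
`top` bounds them above by the same number. -/
theorem IsLRArray.eq_ite {g : ℕ → ℕ → ℕ} (H : IsLRArray a 0 b g) (i r : ℕ) :
    g i r = if r < i then a r else 0 := by
  split_ifs with h
  · exact H.top i r h
  · exact H.eq_zero_of_le (lm := 0) (fun _ _ => rfl) i r (by omega)

theorem sum_range_ite (f : ℕ → ℕ) (n i : ℕ) :
    ∑ x ∈ range n, (if x < i then f x else 0) = ∑ x ∈ range (min n i), f x := by
  rw [← sum_filter]
  congr 1
  ext x
  simp

theorem IsLRArray.outer_eq_content {g : ℕ → ℕ → ℕ} (H : IsLRArray a 0 b g) : a = b := by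
  funext i
  obtain ⟨n₀, hn₀⟩ := H.content i
  have h1 := hn₀ (n₀ + i + 1) (by omega)
  simp only [H.eq_ite, sum_range_ite] at h1
  rw [min_eq_right (by omega), min_eq_right (by omega), sum_range_succ] at h1
  omega

theorem arrayCount_left_zero {f : ℕ → ℕ} (hf : Antitone f) : arrayCount f 0 f = 1 := by
  rw [arrayCount, Set.ncard_eq_one]
  refine ⟨fun i r => if r < i then f r else 0, Set.eq_singleton_iff_unique_mem.2 ⟨?_, ?_⟩⟩
  · refine ⟨fun r => by simp, fun i r => ?_, fun i r h => if_pos h, fun i r => ?_, fun i r => ?_,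
      fun i => ⟨i + 1, fun n hn => ?_⟩⟩
    · split_ifs <;> omega
    · have := hf (Nat.le_succ r)
      split_ifs <;> omega
    · simp only [sum_range_ite]
      by_cases hr : r ≤ i
      · rw [min_eq_left (by omega), min_eq_left (by omega), min_eq_left (by omega),
          min_eq_left (by omega)]
      · rw [min_eq_right (by omega), min_eq_right (by omega), min_eq_right (by omega),
          min_eq_right (by omega), sum_range_succ _ (i + 1), sum_range_succ _ i]
        have := hf (Nat.le_succ i)
        simp only [Nat.succ_eq_add_one] at this
        omega
    · simp only [sum_range_ite]
      rw [min_eq_right (by omega), min_eq_right (by omega), sum_range_succ]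
  · intro g (H : IsLRArray f 0 f g)
    funext i r
    exact H.eq_ite i r

end Trivial

end SkewDurfee

/-! ### Hives and their rotation. -/

namespace SkewDurfee

open Finset

/-- Integer hives with boundary given by partial sums of `a`, `m`, `b`, on the triangle
`i ≤ r ≤ l`; off the triangle the value is `0`. -/
structure IsHive (l : ℕ) (a m b : ℕ → ℕ) (H : ℕ → ℕ → ℤ) : Prop where
  left : ∀ r ≤ l, H 0 r = ∑ x ∈ range r, (m x : ℤ)
  diag : ∀ r ≤ l, H r r = ∑ x ∈ range r, (a x : ℤ)
  bottom : ∀ i ≤ l, H i l = ∑ x ∈ range l, (m x : ℤ) + ∑ x ∈ range i, (b x : ℤ)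
  off : ∀ i r, ¬(i ≤ r ∧ r ≤ l) → H i r = 0
  -- The case `i = r` is omitted, so that these are the rhombi of one orientation inside the
  -- triangle and rotation permutes the three families. It is recovered in `diag_nonneg`.
  mono : ∀ i r, i < r → r < l → H (i + 1) r + H i (r + 1) ≤ H (i + 1) (r + 1) + H i r
  strip : ∀ i r, i ≤ r → r + 2 ≤ l → H (i + 1) (r + 2) + H i r ≤ H i (r + 1) + H (i + 1) (r + 1)
  lattice : ∀ i r, i + 1 ≤ r → r < l → H (i + 2) (r + 1) + H i r ≤ H (i + 1) r + H (i + 1) (r + 1)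

/-- The hive of a Littlewood–Richardson array. -/
def toHive (l : ℕ) (g : ℕ → ℕ → ℕ) (i r : ℕ) : ℤ :=
  if i ≤ r ∧ r ≤ l then ∑ x ∈ range r, (g i x : ℤ) else 0

/-- The Littlewood–Richardson array of a hive. -/
def ofHive (l : ℕ) (a : ℕ → ℕ) (H : ℕ → ℕ → ℤ) (i r : ℕ) : ℕ :=
  if i ≤ r then if r < l then (H i (r + 1) - H i r).toNat else 0 else a r

variable {l : ℕ} {a m b : ℕ → ℕ}

theorem toHive_apply {g : ℕ → ℕ → ℕ} {i r : ℕ} (hi : i ≤ r) (hr : r ≤ l) :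
    toHive l g i r = ∑ x ∈ range r, (g i x : ℤ) := if_pos ⟨hi, hr⟩

theorem sum_range_eq_of_le {f : ℕ → ℕ} (hf : ∀ x, l ≤ x → f x = 0) {n : ℕ} (hn : l ≤ n) :
    ∑ x ∈ range n, f x = ∑ x ∈ range l, f x := by
  refine (sum_subset (range_mono hn) fun x _ hx => hf x ?_).symm
  rwa [mem_range, not_lt] at hx

theorem IsLRArray.isHive {g : ℕ → ℕ → ℕ} (h : IsLRArray a m b g) (ha : ∀ r, l ≤ r → a r = 0) :
    IsHive l a m b (toHive l g) where
  left r hr := by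
    rw [toHive_apply (Nat.zero_le r) hr]
    exact sum_congr rfl fun x _ => by rw [h.zero]
  diag r hr := by
    rw [toHive_apply le_rfl hr]
    exact sum_congr rfl fun x hx => by rw [h.top r x (mem_range.1 hx)]
  bottom i hi := by
    have hg : ∀ i x, l ≤ x → g i x = 0 := fun i x hx => by
      have := h.le_outer i x
      rw [ha x hx] at this
      omega
    have hsum : ∀ i, ∑ x ∈ range l, g i x = ∑ x ∈ range l, m x + ∑ x ∈ range i, b x := by
      intro i
      induction i with
      | zero => simp [h.zero]
      | succ i ih =>
        obtain ⟨n₀, hn₀⟩ := h.content i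
        have := hn₀ (n₀ + l) (by omega)
        rw [sum_range_eq_of_le (hg _) (by omega : l ≤ n₀ + l),
          sum_range_eq_of_le (hg _) (by omega : l ≤ n₀ + l)] at this
        rw [this, ih, sum_range_succ, add_assoc]
    rw [toHive_apply hi le_rfl]
    exact_mod_cast hsum i
  off i r hir := if_neg hir
  mono i r hi hr := by
    rw [toHive_apply (by omega) (by omega), toHive_apply (by omega) (by omega),
      toHive_apply (by omega) (by omega), toHive_apply (by omega) (by omega), sum_range_succ,
      sum_range_succ]
    have := h.mono i r
    omega
  strip i r hi hr := by
    rw [toHive_apply (by omega) (by omega), toHive_apply (by omega) (by omega),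
      toHive_apply (by omega) (by omega), toHive_apply (by omega) (by omega),
      sum_range_succ _ (r + 1), sum_range_succ _ r, sum_range_succ _ r]
    have := h.strip i r
    omega
  lattice i r hi hr := by
    rw [toHive_apply (by omega) (by omega), toHive_apply (by omega) (by omega),
      toHive_apply (by omega) (by omega), toHive_apply (by omega) (by omega)]
    have := h.lattice i r
    zify at this
    linarith

namespace IsHive

variable {H : ℕ → ℕ → ℤ}

theorem row_mono (h : IsHive l a m b H) {i r : ℕ} (hi : i ≤ r) (hr : r < l) :
    H 0 (r + 1) - H 0 r ≤ H i (r + 1) - H i r := by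
  induction i with
  | zero => rfl
  | succ i ih =>
    have := ih (by omega)
    have := h.mono i r (by omega) hr
    linarith

theorem cast_ofHive (h : IsHive l a m b H) {i r : ℕ} (hi : i ≤ r) (hr : r < l) :
    (ofHive l a H i r : ℤ) = H i (r + 1) - H i r := by
  rw [ofHive, if_pos hi, if_pos hr, Int.toNat_of_nonneg]
  have := h.row_mono hi hr
  rw [h.left _ hr.le, h.left _ hr, sum_range_succ] at this
  omega

theorem sum_ofHive (h : IsHive l a m b H) {i r : ℕ} (hi : i ≤ r) (hr : r ≤ l) :
    ∑ x ∈ range r, (ofHive l a H i x : ℤ) = H i r := by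
  induction r, hi using Nat.le_induction with
  | base =>
    rw [h.diag i hr]
    refine sum_congr rfl fun x hx => ?_
    rw [mem_range] at hx
    rw [ofHive, if_neg (by omega)]
  | succ r hi ih =>
    rw [sum_range_succ, ih (by omega), h.cast_ofHive hi (by omega)]
    ring

theorem sum_ofHive_of_lt {i r : ℕ} (hi : r ≤ i) :
    ∑ x ∈ range r, ofHive l a H i x = ∑ x ∈ range r, a x := by
  refine sum_congr rfl fun x hx => ?_
  rw [mem_range] at hx
  rw [ofHive, if_neg (by omega)]

/-- By the lattice rhombi, the number of entries `r + 1` in row `r` decreases weakly with `r`; the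
last of these numbers is `b (l - 1) ≥ 0`. -/
theorem diag_nonneg (h : IsHive l a m b H) {r : ℕ} (hr : r < l) :
    H r (r + 1) ≤ H (r + 1) (r + 1) := by
  have key : ∀ k r, r + k + 1 = l → H r (r + 1) ≤ H (r + 1) (r + 1) := by
    intro k
    induction k with
    | zero =>
      intro r hk
      obtain rfl : l = r + 1 := by omega
      rw [h.bottom r (by omega), h.bottom (r + 1) (by omega),
        sum_range_succ (fun x => (b x : ℤ)) r]
      omega
    | succ k ih =>
      intro r hk
      have := ih (r + 1) (by omega)
      have := h.lattice r (r + 1) le_rfl (by omega)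
      linarith
  exact key (l - r - 1) r (by omega)

theorem ofHive_mono (h : IsHive l a m b H) (ha : ∀ r, l ≤ r → a r = 0) (i r : ℕ) :
    ofHive l a H i r ≤ ofHive l a H (i + 1) r := by
  rcases lt_or_ge r l with hr | hr
  · rcases lt_trichotomy i r with hi | rfl | hi
    · zify
      rw [h.cast_ofHive hi.le hr, h.cast_ofHive hi hr]
      linarith [h.mono i r hi hr]
    · zify
      rw [h.cast_ofHive le_rfl hr, ofHive, if_neg (by omega), h.diag i hr.le]
      have h1 := h.diag_nonneg hr
      rw [h.diag (i + 1) hr, sum_range_succ] at h1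
      linarith
    · rw [ofHive, ofHive, if_neg (by omega), if_neg (by omega)]
  · simp [ofHive, ha r hr, hr.not_gt]

theorem ofHive_eq_zero (ha : ∀ r, l ≤ r → a r = 0) (i r : ℕ) (hr : l ≤ r) :
    ofHive l a H i r = 0 := by
  simp [ofHive, ha r hr, hr.not_gt]

theorem ofHive_content (h : IsHive l a m b H) (hb : ∀ r, l ≤ r → b r = 0) (i : ℕ) :
    ∑ x ∈ range l, ofHive l a H (i + 1) x = ∑ x ∈ range l, ofHive l a H i x + b i := by
  rcases lt_or_ge i l with hi | hi
  · zify
    rw [h.sum_ofHive hi le_rfl, h.sum_ofHive hi.le le_rfl, h.bottom _ hi, h.bottom _ hi.le,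
      sum_range_succ _ i, add_assoc]
  · rw [sum_ofHive_of_lt hi, sum_ofHive_of_lt (by omega), hb i hi, add_zero]

theorem isLRArray (h : IsHive l a m b H) (ha : ∀ r, l ≤ r → a r = 0) (hm : ∀ r, l ≤ r → m r = 0)
    (hb : ∀ r, l ≤ r → b r = 0) (ha' : Antitone a) (hb' : Antitone b) :
    IsLRArray a m b (ofHive l a H) where
  zero r := by
    rcases lt_or_ge r l with hr | hr
    · zify
      rw [h.cast_ofHive (Nat.zero_le r) hr, h.left _ hr, h.left _ hr.le, sum_range_succ]
      ring
    · rw [ofHive_eq_zero ha _ _ hr, hm r hr]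
  mono := h.ofHive_mono ha
  top i r hir := if_neg (by omega)
  strip i r := by
    rcases lt_or_ge (r + 1) l with hr | hr
    · rcases le_or_gt i r with hi | hi
      · zify
        rw [h.cast_ofHive hi (by omega), h.cast_ofHive (by omega) hr]
        linarith [h.strip i r hi hr]
      · rw [ofHive, ofHive, if_neg (by omega), if_neg (by omega)]
        exact ha' (Nat.le_succ r)
    · rw [ofHive_eq_zero ha _ _ hr]
      exact Nat.zero_le _
  lattice i r := by
    have hmono : ∑ x ∈ range r, ofHive l a H i x ≤ ∑ x ∈ range r, ofHive l a H (i + 1) x :=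
      sum_le_sum fun x _ => h.ofHive_mono ha i x
    rcases lt_or_ge i r with hi | hi
    · rcases lt_or_ge r l with hr | hr
      · zify
        rcases lt_or_ge (i + 1) r with hi' | hi'
        all_goals
          rw [h.sum_ofHive (by omega) (by omega), h.sum_ofHive (by omega) (by omega),
            h.sum_ofHive (by omega) (by omega), h.sum_ofHive (by omega) (by omega)]
          linarith [h.lattice i r hi hr]
      -- Past the last row the inequality becomes `b (i + 1) ≤ b i`.
      · have h1 := h.ofHive_content hb i
        have h2 := h.ofHive_content hb (i + 1)
        have h3 := hb' (Nat.le_succ i)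
        rw [sum_range_eq_of_le (ofHive_eq_zero ha _) (by omega : l ≤ r + 1),
          sum_range_eq_of_le (ofHive_eq_zero ha _) (by omega : l ≤ r + 1),
          sum_range_eq_of_le (ofHive_eq_zero ha _) hr, sum_range_eq_of_le (ofHive_eq_zero ha _) hr]
        simp only [Nat.succ_eq_add_one] at h3
        rw [show i + 1 + 1 = i + 2 from rfl] at *
        omega
    · rw [sum_ofHive_of_lt (i := i + 2) (by omega), sum_ofHive_of_lt (i := i + 1) (by omega)]
      omega
  content i := ⟨l, fun n hn => by
    rw [sum_range_eq_of_le (ofHive_eq_zero ha _) hn, sum_range_eq_of_le (ofHive_eq_zero ha _) hn,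
      h.ofHive_content hb]⟩

end IsHive

/-- The number of hives. -/
noncomputable def hiveCount (l : ℕ) (a m b : ℕ → ℕ) : ℕ := {H | IsHive l a m b H}.ncard

theorem arrayCount_eq_hiveCount (ha : ∀ r, l ≤ r → a r = 0) (hm : ∀ r, l ≤ r → m r = 0)
    (hb : ∀ r, l ≤ r → b r = 0) (ha' : Antitone a) (hb' : Antitone b) :
    arrayCount a m b = hiveCount l a m b := by
  refine ncard_eq_of_invOn (f := toHive l) (f' := ofHive l a)
    (fun g (h : IsLRArray a m b g) => h.isHive ha)
    (fun H (h : IsHive l a m b H) => h.isLRArray ha hm hb ha' hb')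
    (fun g (h : IsLRArray a m b g) => ?_) (fun H (h : IsHive l a m b H) => ?_)
  · funext i r
    rcases le_or_gt i r with hi | hi
    · rcases lt_or_ge r l with hr | hr
      · zify
        rw [(h.isHive ha).cast_ofHive hi hr, toHive_apply (by omega) hr, toHive_apply hi hr.le,
          sum_range_succ]
        ring
      · have := h.le_outer i r
        rw [ha r hr] at this
        rw [IsHive.ofHive_eq_zero ha i r hr]
        omega
    · rw [ofHive, if_neg (by omega), h.top i r hi]
  · funext i r
    by_cases hir : i ≤ r ∧ r ≤ l
    · rw [toHive_apply hir.1 hir.2, h.sum_ofHive hir.1 hir.2]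
    · rw [h.off i r hir, toHive, if_neg hir]

/-- The partition sequence complementary to `x` in the square of size `l`. -/
def complSeq (l : ℕ) (x : ℕ → ℕ) (r : ℕ) : ℕ := if r < l then l - x (l - 1 - r) else 0

theorem sum_complSeq {x : ℕ → ℕ} (hx : ∀ r, x r ≤ l) {p r : ℕ} (hp : p + r = l) :
    ∑ j ∈ range r, (complSeq l x j : ℤ) =
      r * l - ∑ j ∈ range l, (x j : ℤ) + ∑ j ∈ range p, (x j : ℤ) := by
  induction r generalizing p with
  | zero =>
    obtain rfl : p = l := by omega
    simp
  | succ r ih =>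
    have h1 := hx p
    rw [sum_range_succ, ih (by omega : p + 1 + r = l), sum_range_succ _ p, complSeq,
      if_pos (by omega), show l - 1 - r = p by omega]
    push_cast [h1]
    ring

/-- Rotation of hives. -/
def rotateHive (l : ℕ) (A : ℤ) (H : ℕ → ℕ → ℤ) (i r : ℕ) : ℤ :=
  if i ≤ r ∧ r ≤ l then r * l - A + H (l - r) (l - r + i) else 0

/-- Inverse rotation of hives. -/
def unrotateHive (l : ℕ) (A : ℤ) (H : ℕ → ℕ → ℤ) (p q : ℕ) : ℤ :=
  if p ≤ q ∧ q ≤ l then H (q - p) (l - p) - (l - p : ℕ) * l + A else 0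

theorem rotateHive_apply {A : ℤ} {H : ℕ → ℕ → ℤ} {p r i : ℕ} (hp : p + r = l) (hi : i ≤ r) :
    rotateHive l A H i r = r * l - A + H p (p + i) := by
  rw [rotateHive, if_pos ⟨hi, by omega⟩, show l - r = p by omega]

theorem unrotateHive_apply {A : ℤ} {H : ℕ → ℕ → ℤ} {p q r i : ℕ} (hp : p + r = l) (hi : i ≤ r)
    (hq : p + i = q) : unrotateHive l A H p q = H i r - r * l + A := by
  rw [unrotateHive, if_pos ⟨by omega, by omega⟩, show l - p = r by omega,
    show q - p = i by omega]

/-- The index map `(i, r) ↦ (l - r, l - r + i)` turns the triangle, permuting its sides and the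
three rhombus families cyclically. The added term `r * l - A` is affine, so it cancels in every
rhombus; on two sides it turns partial sums into those of the complements, and it makes the new
corner value `0`. -/
theorem IsHive.rotate {H : ℕ → ℕ → ℤ} (h : IsHive l a m b H) (ha : ∀ r, a r ≤ l)
    (hb : ∀ r, b r ≤ l) :
    IsHive l (complSeq l b) (complSeq l a) m
      (rotateHive l (∑ x ∈ range l, (a x : ℤ)) H) where
  left r hr := by
    obtain ⟨p, hp⟩ : ∃ p, p + r = l := ⟨l - r, by omega⟩
    rw [rotateHive_apply hp (Nat.zero_le r), sum_complSeq ha hp, add_zero, h.diag p (by omega)]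
  diag r hr := by
    obtain ⟨p, hp⟩ : ∃ p, p + r = l := ⟨l - r, by omega⟩
    -- The corner `(l, l)` lies on two sides, so the sizes satisfy `|a| = |m| + |b|`.
    have h1 := h.diag l le_rfl
    rw [h.bottom l le_rfl] at h1
    rw [rotateHive_apply hp le_rfl, sum_complSeq hb hp, hp, h.bottom p (by omega)]
    linarith
  bottom i hi := by
    rw [rotateHive_apply (zero_add l) hi, sum_complSeq ha (zero_add l), zero_add,
      h.left i hi]
    simp
  off i r hir := if_neg hir
  mono i r hi hr := by
    obtain ⟨p, hp⟩ : ∃ p, p + 1 + r = l := ⟨l - r - 1, by omega⟩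
    have key := h.strip p (p + i) (by omega) (by omega)
    rw [rotateHive_apply hp hi, rotateHive_apply (by omega : p + (r + 1) = l) (by omega),
      rotateHive_apply (by omega : p + (r + 1) = l) (by omega), rotateHive_apply hp hi.le,
      show p + 1 + (i + 1) = p + i + 2 by omega, show p + (i + 1) = p + i + 1 by omega,
      show p + 1 + i = p + i + 1 by omega]
    linarith
  strip i r hi hr := by
    obtain ⟨p, hp⟩ : ∃ p, p + 2 + r = l := ⟨l - r - 2, by omega⟩
    have key := h.lattice p (p + i + 1) (by omega) (by omega)
    rw [rotateHive_apply (by omega : p + (r + 2) = l) (by omega), rotateHive_apply hp hi,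
      rotateHive_apply (by omega : p + 1 + (r + 1) = l) (by omega),
      rotateHive_apply (by omega : p + 1 + (r + 1) = l) (by omega),
      show p + (i + 1) = p + i + 1 by omega, show p + 2 + i = p + i + 1 + 1 by omega,
      show p + 1 + i = p + i + 1 by omega, show p + 1 + (i + 1) = p + i + 1 + 1 by omega]
    push_cast
    linarith
  lattice i r hi hr := by
    obtain ⟨p, hp⟩ : ∃ p, p + 1 + r = l := ⟨l - r - 1, by omega⟩
    have key := h.mono p (p + i + 1) (by omega) (by omega)
    rw [rotateHive_apply (by omega : p + (r + 1) = l) (by omega),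
      rotateHive_apply hp (by omega), rotateHive_apply hp (by omega),
      rotateHive_apply (by omega : p + (r + 1) = l) (by omega),
      show p + (i + 2) = p + i + 1 + 1 by omega, show p + 1 + i = p + i + 1 by omega,
      show p + 1 + (i + 1) = p + i + 1 + 1 by omega, show p + (i + 1) = p + i + 1 by omega]
    linarith

theorem IsHive.unrotate {H : ℕ → ℕ → ℤ} (h : IsHive l (complSeq l b) (complSeq l a) m H)
    (ha : ∀ r, a r ≤ l) (hb : ∀ r, b r ≤ l) :
    IsHive l a m b (unrotateHive l (∑ x ∈ range l, (a x : ℤ)) H) where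
  left q hq := by
    rw [unrotateHive_apply (zero_add l) hq (zero_add q), h.bottom q hq,
      sum_complSeq ha (zero_add l), range_zero, sum_empty]
    ring
  diag p hp := by
    obtain ⟨r, hr⟩ : ∃ r, p + r = l := ⟨l - p, by omega⟩
    rw [unrotateHive_apply hr (Nat.zero_le r) (add_zero p), h.left r (by omega),
      sum_complSeq ha hr]
    ring
  bottom p hp := by
    obtain ⟨r, hr⟩ : ∃ r, p + r = l := ⟨l - p, by omega⟩
    have h1 := h.diag l le_rfl
    rw [h.bottom l le_rfl, sum_complSeq ha (zero_add l), sum_complSeq hb (zero_add l)] at h1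
    simp only [range_zero, sum_empty] at h1
    rw [unrotateHive_apply hr le_rfl hr, h.diag r (by omega), sum_complSeq hb hr]
    linarith
  off p q hpq := if_neg hpq
  mono p q hp hq := by
    obtain ⟨j, rfl⟩ : ∃ j, q = p + (j + 1) := ⟨q - p - 1, by omega⟩
    obtain ⟨s, hs⟩ : ∃ s, p + (s + 1) = l := ⟨l - p - 1, by omega⟩
    have key := h.lattice j s (by omega) (by omega)
    rw [unrotateHive_apply (i := j) (by omega : p + 1 + s = l) (by omega) (by omega),
      unrotateHive_apply (i := j + 2) hs (by omega) (by omega),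
      unrotateHive_apply (i := j + 1) (by omega : p + 1 + s = l) (by omega) (by omega),
      unrotateHive_apply (i := j + 1) hs (by omega) (by omega)]
    linarith
  strip p q hp hq := by
    obtain ⟨i, rfl⟩ : ∃ i, q = p + i := ⟨q - p, by omega⟩
    obtain ⟨s, hs⟩ : ∃ s, p + (s + 1) = l := ⟨l - p - 1, by omega⟩
    have key := h.mono i s (by omega) (by omega)
    rw [unrotateHive_apply (i := i + 1) (by omega : p + 1 + s = l) (by omega) (by omega),
      unrotateHive_apply (i := i) hs (by omega) (by omega),
      unrotateHive_apply (i := i + 1) hs (by omega) (by omega),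
      unrotateHive_apply (i := i) (by omega : p + 1 + s = l) (by omega) (by omega)]
    linarith
  lattice p q hp hq := by
    obtain ⟨i, rfl⟩ : ∃ i, q = p + (i + 1) := ⟨q - p - 1, by omega⟩
    obtain ⟨s, hs⟩ : ∃ s, p + 2 + s = l := ⟨l - p - 2, by omega⟩
    have key := h.strip i s (by omega) (by omega)
    rw [unrotateHive_apply (i := i) hs (by omega) (by omega),
      unrotateHive_apply (i := i + 1) (by omega : p + (s + 2) = l) (by omega) (by omega),
      unrotateHive_apply (i := i) (by omega : p + 1 + (s + 1) = l) (by omega) (by omega),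
      unrotateHive_apply (i := i + 1) (by omega : p + 1 + (s + 1) = l) (by omega) (by omega)]
    push_cast
    linarith

theorem hiveCount_rotate (ha : ∀ r, a r ≤ l) (hb : ∀ r, b r ≤ l) :
    hiveCount l a m b = hiveCount l (complSeq l b) (complSeq l a) m := by
  refine ncard_eq_of_invOn (f := rotateHive l (∑ x ∈ range l, (a x : ℤ)))
    (f' := unrotateHive l (∑ x ∈ range l, (a x : ℤ)))
    (fun H (h : IsHive l a m b H) => h.rotate ha hb)
    (fun H (h : IsHive l (complSeq l b) (complSeq l a) m H) => h.unrotate ha hb)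
    (fun H (h : IsHive l a m b H) => ?_)
    (fun H (h : IsHive l (complSeq l b) (complSeq l a) m H) => ?_)
  · funext p q
    by_cases hpq : p ≤ q ∧ q ≤ l
    · obtain ⟨i, rfl⟩ : ∃ i, q = p + i := ⟨q - p, by omega⟩
      obtain ⟨r, hr⟩ : ∃ r, p + r = l := ⟨l - p, by omega⟩
      rw [unrotateHive_apply hr (by omega) rfl, rotateHive_apply hr (by omega)]
      ring
    · rw [h.off p q hpq, unrotateHive, if_neg hpq]
  · funext i r
    by_cases hir : i ≤ r ∧ r ≤ l
    · obtain ⟨p, hp⟩ : ∃ p, p + r = l := ⟨l - r, by omega⟩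
      rw [rotateHive_apply hp hir.1, unrotateHive_apply hp hir.1 rfl]
      ring
    · rw [h.off i r hir, rotateHive, if_neg hir]

end SkewDurfee

/-! ### Young diagrams, and coefficients after removal of the outer hook. -/

namespace SkewDurfee

open Finset

section Diagram

variable {nu : YoungDiagram}

theorem diagram_ext {mu nu : YoungDiagram} (h : ∀ i j, (i, j) ∈ mu ↔ (i, j) ∈ nu) : mu = nu :=
  SetLike.ext fun c => h c.1 c.2

theorem diagram_ext_rowLen {mu nu : YoungDiagram} (h : mu.rowLen = nu.rowLen) : mu = nu :=
  diagram_ext fun i j => by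
    rw [YoungDiagram.mem_iff_lt_rowLen, YoungDiagram.mem_iff_lt_rowLen, h]

theorem rowLen_antitone (nu : YoungDiagram) : Antitone nu.rowLen := fun i j h => nu.rowLen_anti i j h

theorem rowLen_pos_iff {r : ℕ} : 0 < nu.rowLen r ↔ r < nu.colLen 0 := by
  rw [← YoungDiagram.mem_iff_lt_rowLen, YoungDiagram.mem_iff_lt_colLen]

theorem rowLen_eq_zero {r : ℕ} (h : nu.colLen 0 ≤ r) : nu.rowLen r = 0 := by
  have := (rowLen_pos_iff (nu := nu) (r := r)).1
  omega

theorem rowLen_bot : (⊥ : YoungDiagram).rowLen = 0 := by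
  funext r
  by_contra h
  exact YoungDiagram.notMem_bot (r, 0) (YoungDiagram.mem_iff_lt_rowLen.2 (Nat.pos_of_ne_zero h))

theorem eq_bot_of_zero_notMem (h : (0, 0) ∉ nu) : nu = ⊥ :=
  diagram_ext fun _ _ => ⟨fun h' => absurd (nu.up_left_mem (Nat.zero_le _) (Nat.zero_le _) h') h,
    fun h' => absurd h' (YoungDiagram.notMem_bot _)⟩

theorem le_of_rowLen_le {mu nu : YoungDiagram} (h : ∀ r, mu.rowLen r ≤ nu.rowLen r) : mu ≤ nu := by
  rintro ⟨i, j⟩ hij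
  exact YoungDiagram.mem_iff_lt_rowLen.2 ((YoungDiagram.mem_iff_lt_rowLen.1 hij).trans_le (h i))

/-- The diagram without its first row and its first column. -/
def strip (nu : YoungDiagram) : YoungDiagram where
  cells := nu.cells.filter fun c => (c.1 + 1, c.2 + 1) ∈ nu
  isLowerSet := by
    rintro ⟨a, b⟩ ⟨a', b'⟩ ⟨h1, h2⟩ h
    simp only [coe_filter, Set.mem_ofPred_eq, YoungDiagram.mem_cells] at h ⊢
    exact ⟨nu.up_left_mem h1 h2 h.1,
      nu.up_left_mem (Nat.add_le_add_right h1 1) (Nat.add_le_add_right h2 1) h.2⟩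

theorem mem_strip {i j : ℕ} : (i, j) ∈ strip nu ↔ (i + 1, j + 1) ∈ nu := by
  rw [← YoungDiagram.mem_cells, strip, mem_filter, YoungDiagram.mem_cells]
  exact and_iff_right_of_imp fun h => nu.up_left_mem (Nat.le_succ i) (Nat.le_succ j) h

theorem rowLen_strip (r : ℕ) : (strip nu).rowLen r = nu.rowLen (r + 1) - 1 :=
  eq_of_forall_lt_iff fun c => by
    rw [← YoungDiagram.mem_iff_lt_rowLen, mem_strip, YoungDiagram.mem_iff_lt_rowLen]
    omega

theorem colLen_strip (c : ℕ) : (strip nu).colLen c = nu.colLen (c + 1) - 1 :=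
  eq_of_forall_lt_iff fun r => by
    rw [← YoungDiagram.mem_iff_lt_colLen, mem_strip, YoungDiagram.mem_iff_lt_colLen]
    omega

theorem card_strip_lt (h : (0, 0) ∈ nu) : (strip nu).card < nu.card := by
  have hsub : (strip nu).cells.image (fun c => (c.1 + 1, c.2 + 1)) ⊆ nu.cells.erase (0, 0) := by
    rintro ⟨i, j⟩ hij
    simp only [mem_image, Prod.mk.injEq] at hij
    obtain ⟨⟨x, y⟩, hxy, rfl, rfl⟩ := hij
    exact mem_erase.2 ⟨by simp, mem_strip.1 hxy⟩
  have h1 := card_le_card hsub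
  rw [card_image_of_injective, card_erase_of_mem h] at h1
  · have h2 : 0 < nu.cells.card := card_pos.2 ⟨_, h⟩
    show (strip nu).cells.card < nu.cells.card
    omega
  · rintro ⟨a, b⟩ ⟨c, d⟩ hab
    simpa using hab

/-- The diagram with first row of length `p` and first column of length `q` around `nu`. -/
def attach (p q : ℕ) (nu : YoungDiagram) : YoungDiagram where
  cells := (range q ×ˢ range p).filter fun c => c.1 = 0 ∨ c.2 = 0 ∨ (c.1 - 1, c.2 - 1) ∈ nu
  isLowerSet := by
    rintro ⟨a, b⟩ ⟨a', b'⟩ ⟨h1, h2⟩ h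
    simp only [coe_filter, mem_product, mem_range, Set.mem_ofPred_eq] at h h1 h2 ⊢
    refine ⟨⟨by omega, by omega⟩, ?_⟩
    rcases h.2 with h3 | h3 | h3
    · exact Or.inl (by omega)
    · exact Or.inr (Or.inl (by omega))
    · exact Or.inr (Or.inr (nu.up_left_mem (Nat.sub_le_sub_right h1 1)
        (Nat.sub_le_sub_right h2 1) h3))

theorem mem_attach {p q i j : ℕ} :
    (i, j) ∈ attach p q nu ↔ (i < q ∧ j < p) ∧ (i = 0 ∨ j = 0 ∨ (i - 1, j - 1) ∈ nu) := by
  rw [← YoungDiagram.mem_cells, attach, mem_filter, mem_product, mem_range, mem_range]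

theorem rowLen_attach {p q : ℕ} (hq : 0 < q) : (attach p q nu).rowLen 0 = p :=
  eq_of_forall_lt_iff fun c => by
    rw [← YoungDiagram.mem_iff_lt_rowLen, mem_attach]
    simp [hq]

theorem colLen_attach {p q : ℕ} (hp : 0 < p) : (attach p q nu).colLen 0 = q :=
  eq_of_forall_lt_iff fun c => by
    rw [← YoungDiagram.mem_iff_lt_colLen, mem_attach]
    simp [hp]

theorem strip_attach {p q : ℕ} (hp : nu.rowLen 0 < p) (hq : nu.colLen 0 < q) :
    strip (attach p q nu) = nu :=
  diagram_ext fun i j => by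
    rw [mem_strip, mem_attach]
    simp only [Nat.add_sub_cancel, Nat.succ_ne_zero, false_or, and_iff_right_iff_imp]
    intro h
    have h1 := YoungDiagram.mem_iff_lt_rowLen.1 (nu.up_left_mem (Nat.zero_le i) le_rfl h)
    have h2 := YoungDiagram.mem_iff_lt_colLen.1 (nu.up_left_mem le_rfl (Nat.zero_le j) h)
    omega

end Diagram

section Coeff

variable {a m b : YoungDiagram}

theorem exists_isLRArray (h : lrCoeff a m b ≠ 0) :
    ∃ g, IsLRArray a.rowLen m.rowLen b.rowLen g := by
  rw [lrCoeff_eq_arrayCount] at h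
  exact Set.nonempty_of_ncard_ne_zero h

theorem rowLen_le_of_lrCoeff_ne_zero (h : lrCoeff a m b ≠ 0) :
    a.rowLen 0 ≤ m.rowLen 0 + b.rowLen 0 :=
  (exists_isLRArray h).elim fun _ hg => hg.outer_zero_le

theorem colLen_le_of_lrCoeff_ne_zero (h : lrCoeff a m b ≠ 0) :
    a.colLen 0 ≤ m.colLen 0 + b.colLen 0 := by
  obtain ⟨g, hg⟩ := exists_isLRArray h
  have h1 := hg.outer_eq_zero (fun _ => rowLen_eq_zero) (fun _ => rowLen_eq_zero) _ le_rfl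
  have h2 := (rowLen_pos_iff (nu := a) (r := m.colLen 0 + b.colLen 0)).2
  omega

theorem hook_le_of_lrCoeff_ne_zero (h : lrCoeff a m b ≠ 0) (hm : (0, 0) ∈ m) (hb : (0, 0) ∈ b) :
    a.rowLen 0 + a.colLen 0 < m.rowLen 0 + b.rowLen 0 + (m.colLen 0 + b.colLen 0) := by
  have h1 := rowLen_le_of_lrCoeff_ne_zero h
  have h2 := colLen_le_of_lrCoeff_ne_zero h
  rcases h1.lt_or_eq with h3 | h3
  · omega
  · obtain ⟨g, hg⟩ := exists_isLRArray h
    have h4 := hg.outer_eq_zero_of_first_row (fun _ => rowLen_eq_zero) (fun _ => rowLen_eq_zero) h3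
      (YoungDiagram.mem_iff_lt_colLen.1 hm) (YoungDiagram.mem_iff_lt_colLen.1 hb)
    have h5 := (rowLen_pos_iff (nu := a) (r := m.colLen 0 + b.colLen 0 - 1)).2
    have := YoungDiagram.mem_iff_lt_colLen.1 hm
    omega

theorem inner_le_of_lrCoeff_ne_zero (h : lrCoeff a m b ≠ 0) : m ≤ a :=
  (exists_isLRArray h).elim fun _ hg => le_of_rowLen_le hg.inner_le

theorem content_le_of_lrCoeff_ne_zero (h : lrCoeff a m b ≠ 0) : b ≤ a :=
  (exists_isLRArray h).elim fun _ hg => le_of_rowLen_le hg.content_le_outer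

/-- The sharp direction is removed first. This shortens the other one by one in each diagram, which
makes it sharp as well. -/
theorem lrCoeff_strip (hm : (0, 0) ∈ m) (hb : (0, 0) ∈ b)
    (h : (a.rowLen 0 = m.rowLen 0 + b.rowLen 0 ∧ a.colLen 0 + 1 = m.colLen 0 + b.colLen 0) ∨
      (a.rowLen 0 + 1 = m.rowLen 0 + b.rowLen 0 ∧ a.colLen 0 = m.colLen 0 + b.colLen 0)) :
    lrCoeff a m b = lrCoeff (strip a) (strip m) (strip b) := by
  have hstrip : ∀ nu : YoungDiagram, (strip nu).rowLen = fun r => nu.rowLen (r + 1) - 1 :=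
    fun nu => funext rowLen_strip
  have hm1 := YoungDiagram.mem_iff_lt_colLen.1 hm
  have hb1 := YoungDiagram.mem_iff_lt_colLen.1 hb
  have hm2 := YoungDiagram.mem_iff_lt_rowLen.1 hm
  have hb2 := YoungDiagram.mem_iff_lt_rowLen.1 hb
  have hanti : ∀ nu : YoungDiagram, Antitone fun r => nu.rowLen r - 1 :=
    fun nu i j hij => Nat.sub_le_sub_right (nu.rowLen_anti i j hij) 1
  rw [lrCoeff_eq_arrayCount, lrCoeff_eq_arrayCount, hstrip, hstrip, hstrip]
  rcases h with ⟨h1, h2⟩ | ⟨h1, h2⟩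
  · rw [arrayCount_removeRow (rowLen_antitone a) (rowLen_antitone m) (rowLen_antitone b) h1,
      arrayCount_removeColumn (lm := m.colLen 0 - 1) (lb := b.colLen 0 - 1)]
    all_goals
      intro r
      rw [rowLen_pos_iff]
      omega
  · rw [arrayCount_removeColumn (lm := m.colLen 0) (lb := b.colLen 0)
      (fun r => by rw [rowLen_pos_iff, h2]) (fun r => rowLen_pos_iff) (fun r => rowLen_pos_iff),
      arrayCount_removeRow (hanti a) (hanti m) (hanti b) (by omega)]

theorem lrCoeff_bot_right (nu : YoungDiagram) : lrCoeff nu nu ⊥ = 1 := by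
  rw [lrCoeff_eq_arrayCount, rowLen_bot, arrayCount_right_zero (rowLen_antitone nu)]

theorem lrCoeff_bot_left (nu : YoungDiagram) : lrCoeff nu ⊥ nu = 1 := by
  rw [lrCoeff_eq_arrayCount, rowLen_bot, arrayCount_left_zero (rowLen_antitone nu)]

theorem eq_of_lrCoeff_bot_right (h : lrCoeff a m ⊥ ≠ 0) : a = m := by
  obtain ⟨g, hg⟩ := exists_isLRArray h
  rw [rowLen_bot] at hg
  exact diagram_ext_rowLen hg.outer_eq_inner

theorem eq_of_lrCoeff_bot_left (h : lrCoeff a ⊥ b ≠ 0) : a = b := by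
  obtain ⟨g, hg⟩ := exists_isLRArray h
  rw [rowLen_bot] at hg
  exact diagram_ext_rowLen hg.outer_eq_content

end Coeff

/-! ### Principal hook lengths and Durfee sizes in products. -/

section Hook

theorem hl_bot : hl ⊥ = 0 := by
  funext i
  simp [hl]

theorem hl_zero {nu : YoungDiagram} (h : (0, 0) ∈ nu) :
    hl nu 0 + 1 = nu.rowLen 0 + nu.colLen 0 := by
  have h1 := YoungDiagram.mem_iff_lt_rowLen.1 h
  have h2 := YoungDiagram.mem_iff_lt_colLen.1 h
  rw [hl, if_pos h, hookLength]
  omega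

theorem hl_succ (nu : YoungDiagram) (i : ℕ) : hl nu (i + 1) = hl (strip nu) i := by
  rw [hl, hl]
  refine if_congr mem_strip.symm ?_ rfl
  rw [hookLength, hookLength, rowLen_strip, colLen_strip]
  omega

theorem hl_pos_iff {nu : YoungDiagram} {i : ℕ} : 0 < hl nu i ↔ (i, i) ∈ nu := by
  rw [hl]
  split_ifs with h
  · simp [h, hookLength]
  · simp [h]

theorem toLex_le_of_zero_lt {x y : ℕ → ℕ} (h : x 0 < y 0) : toLex x ≤ toLex y :=
  le_of_lt ⟨0, fun j hj => absurd hj (Nat.not_lt_zero j), h⟩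

theorem toLex_le_of_zero_eq {x y : ℕ → ℕ} (h : x 0 = y 0)
    (h' : toLex (fun i => x (i + 1)) ≤ toLex (fun i => y (i + 1))) : toLex x ≤ toLex y := by
  rcases h'.eq_or_lt with h1 | ⟨i, h1, h2⟩
  · refine le_of_eq (congrArg toLex (funext fun i => ?_))
    rcases i with _ | i
    · exact h
    · exact congrFun (toLex.injective h1) i
  · refine le_of_lt ⟨i + 1, fun j hj => ?_, h2⟩
    rcases j with _ | j
    · exact h
    · exact h1 j (Nat.lt_of_succ_lt_succ hj)

/-- The principal hook lengths of a constituent of `[m] ⊗ [b]` are at most the sums of those of `m`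
and `b`; in the case of equality the multiplicity is `1`. -/
theorem hl_of_lrCoeff_ne_zero {a m b : YoungDiagram} (h : lrCoeff a m b ≠ 0) :
    toLex (hl a) ≤ toLex (hl m + hl b) ∧
      (hl a = hl m + hl b → lrCoeff a m b = 1 ∧ lrCoeff a b m = 1) := by
  -- Both orders of the factors are carried along: the rotation puts the second factor inside, and
  -- commutativity of the coefficients is then not needed.
  induction hn : m.card using Nat.strong_induction_on generalizing a m b with
  | _ n ih =>
    subst hn
    by_cases hm : (0, 0) ∈ m
    swap
    · obtain rfl := eq_bot_of_zero_notMem hm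
      obtain rfl := eq_of_lrCoeff_bot_left h
      rw [hl_bot, zero_add]
      exact ⟨le_rfl, fun _ => ⟨lrCoeff_bot_left a, lrCoeff_bot_right a⟩⟩
    by_cases hb : (0, 0) ∈ b
    swap
    · obtain rfl := eq_bot_of_zero_notMem hb
      obtain rfl := eq_of_lrCoeff_bot_right h
      rw [hl_bot, add_zero]
      exact ⟨le_rfl, fun _ => ⟨lrCoeff_bot_right a, lrCoeff_bot_left a⟩⟩
    have ha : (0, 0) ∈ a := inner_le_of_lrCoeff_ne_zero h hm
    have h1 := rowLen_le_of_lrCoeff_ne_zero h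
    have h2 := colLen_le_of_lrCoeff_ne_zero h
    have h3 := hook_le_of_lrCoeff_ne_zero h hm hb
    have ea := hl_zero ha
    have em := hl_zero hm
    have eb := hl_zero hb
    by_cases heq : hl a 0 = hl m 0 + hl b 0
    -- With `h3`, equality of the first hooks means that exactly one of the bounds `h1`, `h2` is
    -- missed, by one.
    · have e1 := lrCoeff_strip hm hb (a := a) (by omega)
      have e2 := lrCoeff_strip hb hm (a := a) (by omega)
      rw [e1] at h
      have := ih _ (card_strip_lt hm) h rfl
      constructor
      · refine toLex_le_of_zero_eq heq ?_
        have e : ∀ nu, (fun i => hl nu (i + 1)) = hl (strip nu) := fun nu => funext (hl_succ nu)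
        have e' : (fun i => (hl m + hl b) (i + 1)) = hl (strip m) + hl (strip b) := by
          rw [← e, ← e]
          rfl
        rw [e, e']
        exact this.1
      · intro hhl
        rw [e1, e2]
        refine this.2 (funext fun i => ?_)
        rw [Pi.add_apply, ← hl_succ, ← hl_succ, ← hl_succ, hhl, Pi.add_apply]
    · exact ⟨toLex_le_of_zero_lt (by rw [Pi.add_apply]; omega),
        fun hhl => absurd (congrFun hhl 0) heq⟩

end Hook

section Durfee

variable {nu : YoungDiagram}

theorem mem_square {d i j : ℕ} : (i, j) ∈ square d ↔ i < d ∧ j < d := by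
  rw [← YoungDiagram.mem_cells, square, mem_product, mem_range, mem_range]

theorem square_succ_le_iff {d : ℕ} : square (d + 1) ≤ nu ↔ (d, d) ∈ nu := by
  constructor
  · intro h
    exact h (mem_square.2 ⟨by omega, by omega⟩)
  · rintro h ⟨i, j⟩ hij
    have hij' := mem_square.1 hij
    exact nu.up_left_mem (by omega) (by omega) h

theorem lt_durfee_iff {i : ℕ} : i < durfee nu ↔ (i, i) ∈ nu := by
  have hbdd : BddAbove {d | square d ≤ nu} := by
    refine ⟨nu.rowLen 0 + 1, fun d hd => ?_⟩
    rcases d with _ | d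
    · omega
    · have h1 := square_succ_le_iff.1 hd
      have h2 := YoungDiagram.mem_iff_lt_rowLen.1 (nu.up_left_mem (Nat.zero_le d) le_rfl h1)
      omega
  have hne : {d | square d ≤ nu}.Nonempty := by
    refine ⟨0, fun c hc => ?_⟩
    have := (mem_square (i := c.1) (j := c.2)).1 hc
    omega
  constructor
  · intro h
    exact Nat.sSup_mem hne hbdd (mem_square.2 ⟨h, h⟩)
  · intro h
    exact le_csSup hbdd (square_succ_le_iff.2 h)

theorem durfee_mono {mu nu : YoungDiagram} (h : mu ≤ nu) : durfee mu ≤ durfee nu :=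
  le_of_forall_lt fun _ hi => lt_durfee_iff.2 (h (lt_durfee_iff.1 hi))

theorem durfee_strip (nu : YoungDiagram) : durfee (strip nu) = durfee nu - 1 :=
  eq_of_forall_lt_iff fun i => by
    rw [lt_durfee_iff, mem_strip, ← lt_durfee_iff]
    omega

/-- The `i`-th principal hook is positive exactly if `i` is below the Durfee size, and a sum is
positive if one summand is. -/
theorem durfee_eq_max_of_hl {a m b : YoungDiagram} (h : hl a = hl m + hl b) :
    durfee a = max (durfee m) (durfee b) :=
  eq_of_forall_lt_iff fun i => by
    rw [lt_max_iff, lt_durfee_iff, lt_durfee_iff, lt_durfee_iff, ← hl_pos_iff, ← hl_pos_iff,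
      ← hl_pos_iff, h, Pi.add_apply]
    omega

/-- There are at least `2 ^ min (d(m), d(b))` constituents of `[m] ⊗ [b]` with maximal principal
hook lengths. -/
theorem exists_maxHook_constituents (m b : YoungDiagram) :
    ∃ F : Finset YoungDiagram, F.card = 2 ^ min (durfee m) (durfee b) ∧
      ∀ a ∈ F, lrCoeff a m b ≠ 0 ∧ hl a = hl m + hl b := by
  classical
  induction hn : m.card using Nat.strong_induction_on generalizing m b with
  | _ n ih =>
    subst hn
    by_cases hm : (0, 0) ∈ m
    swap
    · have hd := lt_durfee_iff.not.2 hm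
      refine ⟨{b}, by rw [card_singleton, min_eq_left (by omega), Nat.eq_zero_of_not_pos hd,
        pow_zero], fun a ha => ?_⟩
      obtain rfl := mem_singleton.1 ha
      rw [eq_bot_of_zero_notMem hm, hl_bot, zero_add, lrCoeff_bot_left]
      exact ⟨one_ne_zero, rfl⟩
    by_cases hb : (0, 0) ∈ b
    swap
    · have hd := lt_durfee_iff.not.2 hb
      refine ⟨{m}, by rw [card_singleton, min_eq_right (by omega), Nat.eq_zero_of_not_pos hd,
        pow_zero], fun a ha => ?_⟩
      obtain rfl := mem_singleton.1 ha
      rw [eq_bot_of_zero_notMem hb, hl_bot, add_zero, lrCoeff_bot_right]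
      exact ⟨one_ne_zero, rfl⟩
    obtain ⟨F, hF, hF'⟩ := ih _ (card_strip_lt hm) (strip m) (strip b) rfl
    have hm1 := YoungDiagram.mem_iff_lt_colLen.1 hm
    have hb1 := YoungDiagram.mem_iff_lt_colLen.1 hb
    have hm2 := YoungDiagram.mem_iff_lt_rowLen.1 hm
    have hb2 := YoungDiagram.mem_iff_lt_rowLen.1 hb
    have hdm := lt_durfee_iff.2 hm
    have hdb := lt_durfee_iff.2 hb
    set p := m.rowLen 0 + b.rowLen 0 with hp
    set q := m.colLen 0 + b.colLen 0 with hq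
    -- Room for an outer hook with row `p` or `p - 1` and column `q` or `q - 1`, so that `strip`
    -- undoes `attach`.
    have hFrow : ∀ a ∈ F, a.rowLen 0 + 2 ≤ p := fun a ha => by
      have h1 := rowLen_le_of_lrCoeff_ne_zero (hF' a ha).1
      rw [rowLen_strip, rowLen_strip] at h1
      have h2 := m.rowLen_anti 0 1 (Nat.zero_le 1)
      have h3 := b.rowLen_anti 0 1 (Nat.zero_le 1)
      simp only [zero_add] at h1
      omega
    have hFcol : ∀ a ∈ F, a.colLen 0 + 2 ≤ q := fun a ha => by
      have h1 := colLen_le_of_lrCoeff_ne_zero (hF' a ha).1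
      rw [colLen_strip, colLen_strip] at h1
      have h2 := m.colLen_anti 0 1 (Nat.zero_le 1)
      have h3 := b.colLen_anti 0 1 (Nat.zero_le 1)
      simp only [zero_add] at h1
      omega
    have hinj : ∀ p' q', p ≤ p' + 1 → q ≤ q' + 1 → (F.image (attach p' q')).card = F.card := by
      intro p' q' hp' hq'
      refine card_image_of_injOn fun a ha a' ha' haa => ?_
      have h1 := hFrow a ha
      have h2 := hFrow a' ha'
      have h3 := hFcol a ha
      have h4 := hFcol a' ha'
      have h5 := congrArg strip haa
      rwa [strip_attach (by omega) (by omega), strip_attach (by omega) (by omega)] at h5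
    have hmem : ∀ p' q', p ≤ p' + 1 → q ≤ q' + 1 →
        (p' = p ∧ q' + 1 = q ∨ p' + 1 = p ∧ q' = q) → ∀ a ∈ F,
        lrCoeff (attach p' q' a) m b ≠ 0 ∧ hl (attach p' q' a) = hl m + hl b := by
      intro p' q' hp' hq' hpq a ha
      have h1 := hFrow a ha
      have h3 := hFcol a ha
      have e := strip_attach (nu := a) (p := p') (q := q') (by omega) (by omega)
      have er := rowLen_attach (nu := a) (p := p') (q := q') (by omega)
      have ec := colLen_attach (nu := a) (p := p') (q := q') (by omega)
      constructor
      · rw [lrCoeff_strip hm hb (by omega), e]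
        exact (hF' a ha).1
      · funext i
        rcases i with _ | i
        · have h00 : (0, 0) ∈ attach p' q' a := mem_attach.2 ⟨⟨by omega, by omega⟩, Or.inl rfl⟩
          have e1 := hl_zero h00
          have e2 := hl_zero hm
          have e3 := hl_zero hb
          rw [Pi.add_apply]
          omega
        · rw [hl_succ, e, (hF' a ha).2, Pi.add_apply, Pi.add_apply, hl_succ, hl_succ]
    -- The two outer hooks of maximal length; their first rows differ, so the number of diagrams
    -- doubles.
    refine ⟨F.image (attach p (q - 1)) ∪ F.image (attach (p - 1) q), ?_, fun a ha => ?_⟩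
    · rw [card_union_of_disjoint, hinj _ _ (by omega) (by omega), hinj _ _ (by omega) (by omega),
        hF, durfee_strip, durfee_strip,
        show min (durfee m) (durfee b) = min (durfee m - 1) (durfee b - 1) + 1 by omega, pow_succ,
        mul_two]
      rw [disjoint_left]
      intro x hx hx'
      obtain ⟨a, ha, rfl⟩ := mem_image.1 hx
      obtain ⟨a', ha', haa⟩ := mem_image.1 hx'
      have h1 := congrArg (fun x : YoungDiagram => x.rowLen 0) haa
      simp only [rowLen_attach (by omega : 0 < q), rowLen_attach (by omega : 0 < q - 1)] at h1
      omega
    · rcases mem_union.1 ha with ha | ha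
      · obtain ⟨a', ha', rfl⟩ := mem_image.1 ha
        exact hmem _ _ (by omega) (by omega) (by omega) a' ha'
      · obtain ⟨a', ha', rfl⟩ := mem_image.1 ha
        exact hmem _ _ (by omega) (by omega) (by omega) a' ha'

/-- The lexicographic bound `hl m + hl b` is attained, so it is `hl` of the product. -/
theorem isMaxHook_prodChar_iff {a m b : YoungDiagram} :
    IsMaxHook (prodChar m b) a ↔ lrCoeff a m b ≠ 0 ∧ hl a = hl m + hl b := by
  constructor
  · rintro ⟨h1, h2⟩
    have h1 : lrCoeff a m b ≠ 0 := h1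
    obtain ⟨F, hF, hF'⟩ := exists_maxHook_constituents m b
    obtain ⟨c, hc⟩ : F.Nonempty := card_pos.1 (by rw [hF]; positivity)
    obtain ⟨h3, h4⟩ := hF' c hc
    have h5 := h2 c h3
    rw [h4] at h5
    exact ⟨h1, toLex.injective (le_antisymm (hl_of_lrCoeff_ne_zero h1).1 h5)⟩
  · rintro ⟨h1, h2⟩
    exact ⟨h1, fun nu hnu => by rw [h2]; exact (hl_of_lrCoeff_ne_zero hnu).1⟩

end Durfee

/-! ### Complements in the square. -/

section Complement

variable {l : ℕ} {nu : YoungDiagram}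

theorem mem_squareCompl {i j : ℕ} :
    (i, j) ∈ squareCompl l nu ↔ (i < l ∧ j < l) ∧ (l - 1 - i, l - 1 - j) ∉ nu := by
  rw [← YoungDiagram.mem_cells, squareCompl, mem_filter, YoungDiagram.mem_cells, mem_square]

theorem squareCompl_squareCompl (h : nu ≤ square l) : squareCompl l (squareCompl l nu) = nu :=
  diagram_ext fun i j => by
    rw [mem_squareCompl, mem_squareCompl]
    constructor
    · rintro ⟨h1, h2⟩
      by_contra h3
      refine h2 ⟨⟨by omega, by omega⟩, ?_⟩
      rwa [show l - 1 - (l - 1 - i) = i by omega, show l - 1 - (l - 1 - j) = j by omega]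
    · intro h1
      have h2 := mem_square.1 (h h1)
      refine ⟨h2, fun h3 => h3.2 ?_⟩
      rwa [show l - 1 - (l - 1 - i) = i by omega, show l - 1 - (l - 1 - j) = j by omega]

theorem squareCompl_le (l : ℕ) (nu : YoungDiagram) : squareCompl l nu ≤ square l := by
  rintro ⟨i, j⟩ h
  exact mem_square.2 (mem_squareCompl.1 h).1

theorem rowLen_squareCompl : (squareCompl l nu).rowLen = complSeq l nu.rowLen := by
  funext r
  refine eq_of_forall_lt_iff fun c => ?_
  rw [← YoungDiagram.mem_iff_lt_rowLen, mem_squareCompl, YoungDiagram.mem_iff_lt_rowLen, complSeq]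
  split_ifs <;> omega

theorem durfee_squareCompl (l : ℕ) (nu : YoungDiagram) :
    durfee (squareCompl l nu) = l - durfee nu :=
  eq_of_forall_lt_iff fun i => by
    rw [lt_durfee_iff, mem_squareCompl, ← lt_durfee_iff]
    omega

theorem le_square_iff : nu ≤ square l ↔ nu.rowLen 0 ≤ l ∧ nu.colLen 0 ≤ l := by
  constructor
  · intro h
    constructor
    · by_contra! hlt
      have := mem_square.1 (h (YoungDiagram.mem_iff_lt_rowLen.2 hlt))
      omega
    · by_contra! hlt
      have := mem_square.1 (h (YoungDiagram.mem_iff_lt_colLen.2 hlt))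
      omega
  · rintro ⟨h1, h2⟩ ⟨i, j⟩ h
    have h3 := YoungDiagram.mem_iff_lt_rowLen.1 (nu.up_left_mem (Nat.zero_le i) le_rfl h)
    have h4 := YoungDiagram.mem_iff_lt_colLen.1 (nu.up_left_mem le_rfl (Nat.zero_le j) h)
    exact mem_square.2 ⟨by omega, by omega⟩

theorem rowLen_le_of_le_square (h : nu ≤ square l) (r : ℕ) : nu.rowLen r ≤ l :=
  (nu.rowLen_anti 0 r (Nat.zero_le r)).trans (le_square_iff.1 h).1

theorem rowLen_eq_zero_of_le_square (h : nu ≤ square l) (r : ℕ) (hr : l ≤ r) : nu.rowLen r = 0 :=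
  rowLen_eq_zero ((le_square_iff.1 h).2.trans hr)

/-- Lower bounds on `Set.ncard` need finiteness, as `ncard` is `0` on infinite sets. -/
theorem finite_setOf_le (nu : YoungDiagram) : {mu : YoungDiagram | mu ≤ nu}.Finite := by
  refine Set.Finite.of_finite_image (f := YoungDiagram.cells)
    ((nu.cells.powerset.finite_toSet).subset ?_) fun x _ y _ h => YoungDiagram.ext h
  rintro _ ⟨mu, hmu, rfl⟩
  exact mem_coe.2 (mem_powerset.2 (YoungDiagram.cells_subset_iff.2 hmu))

/-- Littlewood–Richardson coefficients are invariant under the cyclic rotation of hives. -/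
theorem lrCoeff_rotate {lam mu : YoungDiagram} (hlam : lam ≤ square l) (hmu : mu ≤ square l)
    (hnu : nu ≤ square l) :
    lrCoeff lam mu nu = lrCoeff (squareCompl l nu) (squareCompl l lam) mu := by
  have hcl := squareCompl_le l lam
  have hcn := squareCompl_le l nu
  rw [lrCoeff_eq_arrayCount, lrCoeff_eq_arrayCount,
    arrayCount_eq_hiveCount (rowLen_eq_zero_of_le_square hlam) (rowLen_eq_zero_of_le_square hmu)
      (rowLen_eq_zero_of_le_square hnu) (rowLen_antitone _) (rowLen_antitone _),
    arrayCount_eq_hiveCount (rowLen_eq_zero_of_le_square hcn) (rowLen_eq_zero_of_le_square hcl)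
      (rowLen_eq_zero_of_le_square hmu) (rowLen_antitone _) (rowLen_antitone _),
    rowLen_squareCompl, rowLen_squareCompl,
    hiveCount_rotate (rowLen_le_of_le_square hlam) (rowLen_le_of_le_square hnu)]

end Complement

end SkewDurfee

/-! ### Proof of the proposition. -/

theorem proposition5p4 (lam mu : YoungDiagram) (k l : ℕ)
    -- `lam = (lam₁^k, lam_{k+1}, …, lam_l)` with `lam₁ = l`
    (hlen : lam.colLen 0 ≤ l)
    (hrow : ∀ i < k, lam.rowLen i = lam.rowLen 0)
    (hfirst : lam.rowLen 0 = l)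
    -- `k ≥ l(mu)` and `mu₁ ≤ lam_l` (part number `l` has index `l - 1`; for `l = 0`, `lam` is empty)
    (hk : mu.colLen 0 ≤ k)
    (hmu : mu.rowLen 0 ≤ lam.rowLen (l - 1)) :
    -- the maximal Durfee size
    (IsGreatest (SkewDurfee.durfee '' SkewDurfee.constituents (SkewDurfee.skewChar lam mu))
        (SkewDurfee.charDurfee (SkewDurfee.skewChar lam mu)) ∧
      (SkewDurfee.charDurfee (SkewDurfee.skewChar lam mu) : ℤ) =
        (l : ℤ) - (max (SkewDurfee.durfee mu)
          (SkewDurfee.durfee (SkewDurfee.squareCompl l lam)) : ℕ)) ∧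
    -- the number of characters of maximal Durfee size, and of those with multiplicity `1`
    (2 ^ min (SkewDurfee.durfee mu) (SkewDurfee.durfee (SkewDurfee.squareCompl l lam)) ≤
        {nu | nu ∈ SkewDurfee.constituents (SkewDurfee.skewChar lam mu) ∧
          SkewDurfee.durfee nu =
            SkewDurfee.charDurfee (SkewDurfee.skewChar lam mu)}.ncard ∧
      2 ^ min (SkewDurfee.durfee mu) (SkewDurfee.durfee (SkewDurfee.squareCompl l lam)) ≤
        {nu | SkewDurfee.skewChar lam mu nu = 1 ∧
          SkewDurfee.durfee nu =
            SkewDurfee.charDurfee (SkewDurfee.skewChar lam mu)}.ncard) ∧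
    -- complements of constituents with maximal hook lengths, with multiplicity `1`
    (∀ a, SkewDurfee.IsMaxHook
          (SkewDurfee.prodChar mu (SkewDurfee.squareCompl l lam)) a →
        a ≤ SkewDurfee.square l ∧
        SkewDurfee.squareCompl l a ∈
          SkewDurfee.constituents (SkewDurfee.skewChar lam mu) ∧
        SkewDurfee.durfee (SkewDurfee.squareCompl l a) =
          SkewDurfee.charDurfee (SkewDurfee.skewChar lam mu) ∧
        SkewDurfee.skewChar lam mu (SkewDurfee.squareCompl l a) = 1) ∧
    -- there are enough of these complements
    2 ^ min (SkewDurfee.durfee mu) (SkewDurfee.durfee (SkewDurfee.squareCompl l lam)) ≤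
      (SkewDurfee.squareCompl l '' {a | SkewDurfee.IsMaxHook
        (SkewDurfee.prodChar mu (SkewDurfee.squareCompl l lam)) a}).ncard := by

  classical
  set be := SkewDurfee.squareCompl l lam with hbe
  have hlam : lam ≤ SkewDurfee.square l := SkewDurfee.le_square_iff.2 ⟨hfirst.le, hlen⟩
  have hrowle := SkewDurfee.rowLen_le_of_le_square hlam
  -- For `l > 0` the first part of the complement is `l` minus the last part of `lam`.
  have hsumrow : mu.rowLen 0 + be.rowLen 0 ≤ l := by
    have h1 := hrowle (l - 1)
    rw [hbe, SkewDurfee.rowLen_squareCompl, SkewDurfee.complSeq, Nat.sub_zero]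
    split_ifs <;> omega
  have hbesq : be ≤ SkewDurfee.square l := SkewDurfee.squareCompl_le l lam
  have hsumcol : mu.colLen 0 + be.colLen 0 ≤ l := by
    have h2 := (SkewDurfee.le_square_iff.1 hbesq).2
    by_cases hkl : k ≤ l
    -- The `k` full rows of `lam` leave the last `k` rows of the complement empty.
    · have h3 : be.colLen 0 ≤ l - k := by
        by_contra! h4
        have h5 := SkewDurfee.mem_squareCompl.1 (YoungDiagram.mem_iff_lt_colLen.2 h4)
        rw [YoungDiagram.mem_iff_lt_rowLen] at h5
        have h6 := hrow (l - 1 - (l - k)) (by omega)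
        omega
      omega
    -- Here row `l`, which is empty, equals the first row; hence `l = 0` and `mu` is empty.
    · have h3 := hrow l (by omega)
      rw [SkewDurfee.rowLen_eq_zero hlen] at h3
      have h4 : mu.rowLen 0 = 0 := by omega
      have h5 := (SkewDurfee.rowLen_pos_iff (nu := mu) (r := 0)).2
      omega
  have hmusq : mu ≤ SkewDurfee.square l := SkewDurfee.le_square_iff.2 ⟨by omega, by omega⟩
  have hprodsq : ∀ a, SkewDurfee.lrCoeff a mu be ≠ 0 → a ≤ SkewDurfee.square l := fun a h => by
    have h1 := SkewDurfee.rowLen_le_of_lrCoeff_ne_zero h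
    have h2 := SkewDurfee.colLen_le_of_lrCoeff_ne_zero h
    exact SkewDurfee.le_square_iff.2 ⟨by omega, by omega⟩
  have hskewsq : ∀ nu, SkewDurfee.skewChar lam mu nu ≠ 0 → nu ≤ SkewDurfee.square l :=
    fun nu h => (SkewDurfee.content_le_of_lrCoeff_ne_zero h).trans hlam
  have hupper : ∀ nu, SkewDurfee.skewChar lam mu nu ≠ 0 →
      SkewDurfee.durfee nu ≤ l - max (SkewDurfee.durfee mu) (SkewDurfee.durfee be) := by
    intro nu h
    have hsq := hskewsq nu h
    rw [SkewDurfee.skewChar, SkewDurfee.lrCoeff_rotate hlam hmusq hsq] at h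
    rw [← SkewDurfee.squareCompl_squareCompl hsq, SkewDurfee.durfee_squareCompl]
    -- After rotation the complement of `nu` has inner shape `be` and content `mu`, so it contains
    -- both.
    exact Nat.sub_le_sub_left (max_le
      (SkewDurfee.durfee_mono (SkewDurfee.content_le_of_lrCoeff_ne_zero h))
      (SkewDurfee.durfee_mono (SkewDurfee.inner_le_of_lrCoeff_ne_zero h))) l
  have hmax : ∀ a, SkewDurfee.lrCoeff a mu be ≠ 0 → SkewDurfee.hl a =
      SkewDurfee.hl mu + SkewDurfee.hl be →
      SkewDurfee.skewChar lam mu (SkewDurfee.squareCompl l a) = 1 ∧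
      SkewDurfee.durfee (SkewDurfee.squareCompl l a) =
        l - max (SkewDurfee.durfee mu) (SkewDurfee.durfee be) := by
    intro a h1 h2
    rw [SkewDurfee.durfee_squareCompl, SkewDurfee.durfee_eq_max_of_hl h2, SkewDurfee.skewChar,
      SkewDurfee.lrCoeff_rotate hlam hmusq (SkewDurfee.squareCompl_le l a),
      SkewDurfee.squareCompl_squareCompl (hprodsq a h1)]
    exact ⟨((SkewDurfee.hl_of_lrCoeff_ne_zero h1).2 h2).2, rfl⟩
  obtain ⟨F, hF, hF'⟩ := SkewDurfee.exists_maxHook_constituents mu be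
  have hgreatest : IsGreatest
      (SkewDurfee.durfee '' SkewDurfee.constituents (SkewDurfee.skewChar lam mu))
      (l - max (SkewDurfee.durfee mu) (SkewDurfee.durfee be)) := by
    constructor
    · obtain ⟨a, ha⟩ : F.Nonempty := Finset.card_pos.1 (by rw [hF]; positivity)
      obtain ⟨h1, h2⟩ := hmax a (hF' a ha).1 (hF' a ha).2
      exact ⟨SkewDurfee.squareCompl l a, (by rw [h1]; exact one_ne_zero :
        SkewDurfee.skewChar lam mu (SkewDurfee.squareCompl l a) ≠ 0), h2⟩
    · rintro _ ⟨nu, hnu, rfl⟩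
      exact hupper nu hnu
  have hchar : SkewDurfee.charDurfee (SkewDurfee.skewChar lam mu) =
      l - max (SkewDurfee.durfee mu) (SkewDurfee.durfee be) := hgreatest.csSup_eq
  have hdle : max (SkewDurfee.durfee mu) (SkewDurfee.durfee be) ≤ l := by
    have hd : ∀ nu, nu ≤ SkewDurfee.square l → SkewDurfee.durfee nu ≤ l := fun nu h => by
      rw [← SkewDurfee.squareCompl_squareCompl h, SkewDurfee.durfee_squareCompl]
      exact Nat.sub_le _ _
    exact max_le (hd mu hmusq) (hd be hbesq)
  -- All three counts follow from one fact: complementation is injective on `F`, since its members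
  -- lie in the square.
  have hcard : ∀ S : Set YoungDiagram, (∀ nu ∈ S, nu ≤ SkewDurfee.square l) →
      (∀ a ∈ F, SkewDurfee.squareCompl l a ∈ S) →
      2 ^ min (SkewDurfee.durfee mu) (SkewDurfee.durfee be) ≤ S.ncard := by
    intro S hS hFS
    have hinj : (F.image (SkewDurfee.squareCompl l)).card = F.card := by
      refine Finset.card_image_of_injOn fun a ha a' ha' h => ?_
      rw [← SkewDurfee.squareCompl_squareCompl (hprodsq a (hF' a ha).1), h,
        SkewDurfee.squareCompl_squareCompl (hprodsq a' (hF' a' ha').1)]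
    rw [← hF, ← hinj, ← Set.ncard_coe_finset]
    refine Set.ncard_le_ncard ?_ ((SkewDurfee.finite_setOf_le (SkewDurfee.square l)).subset hS)
    intro x hx
    obtain ⟨a, ha, rfl⟩ := Finset.mem_image.1 (Finset.mem_coe.1 hx)
    exact hFS a ha
  rw [hchar]
  refine ⟨⟨hgreatest, ?_⟩, ⟨?_, ?_⟩, ?_, ?_⟩
  · rw [Nat.cast_sub hdle]
  · refine hcard _ (fun nu h => hskewsq nu h.1) fun a ha => ?_
    obtain ⟨h1, h2⟩ := hmax a (hF' a ha).1 (hF' a ha).2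
    exact ⟨(by rw [h1]; exact one_ne_zero :
      SkewDurfee.skewChar lam mu (SkewDurfee.squareCompl l a) ≠ 0), h2⟩
  · refine hcard _ (fun nu h => hskewsq nu (by rw [h.1]; exact one_ne_zero)) fun a ha => ?_
    exact hmax a (hF' a ha).1 (hF' a ha).2
  · intro a ha
    obtain ⟨h1, h2⟩ := SkewDurfee.isMaxHook_prodChar_iff.1 ha
    obtain ⟨h3, h4⟩ := hmax a h1 h2
    exact ⟨hprodsq a h1, (by rw [h3]; exact one_ne_zero :
      SkewDurfee.skewChar lam mu (SkewDurfee.squareCompl l a) ≠ 0), h4, h3⟩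
  · refine hcard _ ?_ fun a ha => ⟨a, SkewDurfee.isMaxHook_prodChar_iff.2 (hF' a ha), rfl⟩
    rintro _ ⟨a, _, rfl⟩
    exact SkewDurfee.squareCompl_le l a
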